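/- Let $\alpha>1$ and $\beta\in(1,2)$. Let $C^\beta_{\mathrm{even}}(\mathbb T)$ be the Banach space of real-valued, even, $2\pi$-periodic functions on $\mathbb R$ that are continuously differentiable with $(\beta-1)$-Hölder continuous derivative, with norm $\sup|\varphi|+\sup|\varphi'|+\sup_{x\neq y}\frac{|\varphi'(x)-\varphi'(y)|}{|x-y|^{\beta-1}}$, and let $\mathbb R_+=[0,\infty)$. Let $L$ be the Fourier multiplier operator with symbol $m(\xi)=(1+\xi^2)^{-\alpha/2}$ acting on $2\pi$-periodic functions, $$L\varphi(x)=\frac1{2\pi}\sum_{n\in\mathbb Z}m(n)\,\widehat\varphi(n)\,e^{inx},\qquad \widehat\varphi(n)=\int_{-\pi}^{\pi}\varphi(x)e^{-inx}\,dx,$$ and for $(\varphi,\mu)\in C^\beta_{\mathrm{even}}(\mathbb T)\times\mathbb R_+$ set $F(\varphi,\mu)=\mu\varphi-L\varphi-\tfrac12\varphi^2$. A solution $(\varphi,\mu)$ of $F(\varphi,\mu)=0$ is called nontrivial if $\varphi\neq0$. **Theorem.** For each integer $k\ge1$ put $\mu_k^*=(1+k^2)^{-\alpha/2}$. Then $(0,\mu_k^*)$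 is a bifurcation point, i.e. it is a limit in $C^\beta_{\mathrm{even}}(\mathbb T)\times\mathbb R_+$ of nontrivial solutions of $F(\varphi,\mu)=0$. More precisely, there exist $\epsilon_0>0$ and a real-analytic curve $$\{(\varphi_k(\epsilon),\mu_k(\epsilon)):|\epsilon|<\epsilon_0\}\subset C^\beta_{\mathrm{even}}(\mathbb T)\times\mathbb R_+$$ with $\varphi_k(0)=0$ and $\mu_k(0)=\mu_k^*$ such that $F(\varphi_k(\epsilon),\mu_k(\epsilon))=0$ and $\varphi_k(\epsilon)$ is $\frac{2\pi}{k}$-periodic for all $|\epsilon|<\epsilon_0$, $\varphi_k(\epsilon)\ne0$ for $0<|\epsilon|<\epsilon_0$, and the derivative of $\varphi_k$ at $0$ in $C^\beta_{\mathrm{even}}(\mathbb T)$ is $D_\epsilon\varphi_k(0)=\cos(k\,\cdot)$. Moreover, there is a neighborhood of $(0,\mu_k^*)$ in $C^\beta_{\mathrm{even}}(\mathbb T)\times\mathbb R_+$ in which every nontrivial solution of $F(\varphi,\mu)=0$ is of the form $(\varphi_k(\epsilon),\mu_k(\epsilon))$ with $0<|\epsilon|<\epsilon_0$. -/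

import Mathlib

open scoped Topology NNReal

noncomputable section

namespace FKdV

/-- The real vector space of even, `2π`-periodic functions of class `C^{1,β-1}` on the real line;
for `1 < β < 2` this is the Hölder space `C^β_even(𝕋)`. -/
def holderEvenSubmodule (β : ℝ) : Submodule ℝ (ℝ → ℝ) where
  carrier := {f | Function.Periodic f (2 * Real.pi) ∧ Function.Even f ∧ ContDiff ℝ 1 f ∧
    MemHolder (β - 1).toNNReal (deriv f)}
  add_mem' := by
    rintro f g ⟨hf, hf', hf1, hfh⟩ ⟨hg, hg', hg1, hgh⟩
    refine ⟨hf.add hg, hf'.add hg', hf1.add hg1, ?_⟩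
    have h : deriv (f + g) = deriv f + deriv g := by
      funext x
      exact deriv_add (hf1.differentiable one_ne_zero x) (hg1.differentiable one_ne_zero x)
    rw [h]
    exact hfh.add hgh
  zero_mem' := by
    refine ⟨fun _ => rfl, fun _ => rfl, contDiff_const, ?_⟩
    have h : deriv (0 : ℝ → ℝ) = 0 := by
      funext x
      exact deriv_const x (0 : ℝ)
    rw [h]
    exact memHolder_zero
  smul_mem' := by
    rintro c f ⟨hf, hf', hf1, hfh⟩
    refine ⟨fun x => ?_, fun x => ?_, contDiff_const.smul hf1, ?_⟩
    · simp only [Pi.smul_apply, hf x]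
    · simp only [Pi.smul_apply, hf' x]
    have h : deriv (c • f) = c • deriv f := by
      funext x
      exact deriv_const_smul c (hf1.differentiable one_ne_zero x)
    rw [h]
    exact hfh.smul

/-- The space `C^β_even(𝕋)`, `1 < β < 2`, as a type of its own, which carries the Hölder norm
below (and not the topology of pointwise convergence). -/
def HolderEven (β : ℝ) : Type := ↥(holderEvenSubmodule β)

instance (β : ℝ) : AddCommGroup (HolderEven β) :=
  inferInstanceAs (AddCommGroup ↥(holderEvenSubmodule β))

instance (β : ℝ) : Module ℝ (HolderEven β) :=
  inferInstanceAs (Module ℝ ↥(holderEvenSubmodule β))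

instance (β : ℝ) : FunLike (HolderEven β) ℝ ℝ where
  coe f := f.1
  coe_injective _ _ h := Subtype.ext h

namespace HolderEven

variable {β : ℝ}

theorem mem (f : HolderEven β) : Function.Periodic f (2 * Real.pi) ∧ Function.Even f ∧
    ContDiff ℝ 1 f ∧ MemHolder (β - 1).toNNReal (deriv f) := f.2

theorem ext {f g : HolderEven β} (h : ∀ x, f x = g x) : f = g := DFunLike.ext f g h

theorem coe_zero : ((0 : HolderEven β) : ℝ → ℝ) = 0 := rfl

theorem coe_add (f g : HolderEven β) : ((f + g : HolderEven β) : ℝ → ℝ) = ⇑f + ⇑g := rfl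

theorem coe_smul (c : ℝ) (f : HolderEven β) : ((c • f : HolderEven β) : ℝ → ℝ) = c • ⇑f := rfl

theorem differentiable (f : HolderEven β) : Differentiable ℝ f :=
  f.mem.2.2.1.differentiable one_ne_zero

theorem deriv_coe_add (f g : HolderEven β) :
    deriv (f + g : HolderEven β) = deriv f + deriv g := by
  funext x
  exact deriv_add (f.differentiable x) (g.differentiable x)

theorem deriv_coe_smul (c : ℝ) (f : HolderEven β) :
    deriv (c • f : HolderEven β) = c • deriv f := by
  funext x
  exact deriv_const_smul c (f.differentiable x)

/-- The supremum norm of a function on the line. -/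
def supNorm (f : ℝ → ℝ) : ℝ := ⨆ x, |f x|

theorem bddAbove_of_periodic {f : ℝ → ℝ} (hp : Function.Periodic f (2 * Real.pi))
    (hc : Continuous f) : BddAbove (Set.range fun x => |f x|) := by
  have hp' : Function.Periodic (fun x => |f x|) (2 * Real.pi) := fun x => by
    simp only [hp x]
  rw [← hp'.image_Icc Real.two_pi_pos 0]
  exact (isCompact_Icc.image hc.abs).bddAbove

theorem bddAbove_coe (f : HolderEven β) : BddAbove (Set.range fun x => |f x|) :=
  bddAbove_of_periodic f.mem.1 f.mem.2.2.1.continuous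

theorem bddAbove_deriv (f : HolderEven β) : BddAbove (Set.range fun x => |deriv f x|) := by
  refine bddAbove_of_periodic (fun x => ?_) (f.mem.2.2.1.continuous_deriv le_rfl)
  have h : (fun y => f (y + 2 * Real.pi)) = f := funext f.mem.1
  rw [← deriv_comp_add_const, h]

theorem supNorm_nonneg (f : ℝ → ℝ) : 0 ≤ supNorm f := Real.iSup_nonneg fun _ => abs_nonneg _

theorem supNorm_add_le {f g : ℝ → ℝ} (hf : BddAbove (Set.range fun x => |f x|))
    (hg : BddAbove (Set.range fun x => |g x|)) : supNorm (f + g) ≤ supNorm f + supNorm g :=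
  ciSup_le fun x => (abs_add_le (f x) (g x)).trans (add_le_add (le_ciSup hf x) (le_ciSup hg x))

theorem supNorm_smul (c : ℝ) (f : ℝ → ℝ) : supNorm (c • f) = |c| * supNorm f := by
  simp only [supNorm, Pi.smul_apply, smul_eq_mul, abs_mul]
  exact (Real.mul_iSup_of_nonneg (abs_nonneg c) _).symm

/-- The Hölder norm `sup |f| + sup |f'| + [f']_{β-1}`, where
`[g]_γ = sup_{x ≠ y} |g x - g y| / |x - y| ^ γ`. -/
instance : Norm (HolderEven β) :=
  ⟨fun f => supNorm f + supNorm (deriv f) + nnHolderNorm (β - 1).toNNReal (deriv f)⟩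

theorem norm_def (f : HolderEven β) :
    ‖f‖ = supNorm f + supNorm (deriv f) + nnHolderNorm (β - 1).toNNReal (deriv f) := rfl

theorem core : NormedSpace.Core ℝ (HolderEven β) where
  norm_nonneg f := by
    rw [norm_def]
    have h1 := supNorm_nonneg f
    have h2 := supNorm_nonneg (deriv f)
    positivity
  norm_smul c f := by
    rw [norm_def, norm_def, deriv_coe_smul, coe_smul, supNorm_smul, supNorm_smul,
      f.mem.2.2.2.nnHolderNorm_smul]
    push_cast
    rw [Real.norm_eq_abs]
    ring
  norm_triangle f g := by
    rw [norm_def, norm_def, norm_def, deriv_coe_add, coe_add]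
    have h1 := supNorm_add_le f.bddAbove_coe g.bddAbove_coe
    have h2 := supNorm_add_le f.bddAbove_deriv g.bddAbove_deriv
    have h3 : (nnHolderNorm (β - 1).toNNReal (deriv f + deriv g) : ℝ) ≤
        nnHolderNorm (β - 1).toNNReal (deriv f) + nnHolderNorm (β - 1).toNNReal (deriv g) :=
      mod_cast f.mem.2.2.2.nnHolderNorm_add_le g.mem.2.2.2
    linarith
  norm_eq_zero_iff f := by
    constructor
    · intro h
      rw [norm_def] at h
      have h1 := supNorm_nonneg f
      have h2 := supNorm_nonneg (deriv f)
      have h3 := NNReal.coe_nonneg (nnHolderNorm (β - 1).toNNReal (deriv f))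
      have h0 : supNorm f = 0 := by linarith
      refine ext fun x => ?_
      have hx : |f x| ≤ supNorm f := le_ciSup f.bddAbove_coe x
      rw [h0] at hx
      exact abs_eq_zero.mp (le_antisymm hx (abs_nonneg _))
    · rintro rfl
      have h : deriv ((0 : HolderEven β) : ℝ → ℝ) = 0 := by
        funext x
        exact deriv_const x (0 : ℝ)
      rw [norm_def, h, coe_zero]
      simp [supNorm]

instance : NormedAddCommGroup (HolderEven β) := NormedAddCommGroup.ofCore core

instance : NormedSpace ℝ (HolderEven β) := NormedSpace.ofCore core

end HolderEven

/-- The Bessel potential symbol `m(ξ) = (1 + ξ²)^{-α/2}`. -/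
def symbol (α ξ : ℝ) : ℝ := (1 + ξ ^ 2) ^ (-α / 2)

/-- The Fourier coefficient `∫_{-π}^{π} f(x) e^{-inx} dx`. -/
def fourierCoef (f : ℝ → ℝ) (n : ℤ) : ℂ :=
  ∫ x in (-Real.pi)..Real.pi, (f x : ℂ) * Complex.exp (-Complex.I * n * x)

/-- The Fourier multiplier operator with symbol `m` on `2π`-periodic functions,
`L f(x) = (1/2π) ∑ₙ m(n) f̂(n) e^{inx}`. For real `f` the sum is real, because `m` is even; for
`α > 1` and `f` continuous the series converges absolutely. -/
def L (α : ℝ) (f : ℝ → ℝ) (x : ℝ) : ℝ :=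
  (1 / (2 * Real.pi) *
    ∑' n : ℤ, (symbol α n : ℂ) * fourierCoef f n * Complex.exp (Complex.I * n * x)).re

/-- The map `F(φ, μ) = μ φ - L φ - φ² / 2`, as a function on the line. -/
def F (α : ℝ) {β : ℝ} (φ : HolderEven β) (μ : ℝ) : ℝ → ℝ :=
  fun x => μ * φ x - L α φ x - φ x ^ 2 / 2

/-- The pairs `(φ, μ)` in `C^β_even(𝕋) × [0, ∞)` with `F(φ, μ) = 0` and `φ ≠ 0`. -/
def nontrivialSolutions (α β : ℝ) : Set (HolderEven β × ℝ) :=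
  {p | 0 ≤ p.2 ∧ F α p.1 p.2 = 0 ∧ p.1 ≠ 0}

/-- `(0, μ₀)` is a bifurcation point of `F(φ, μ) = 0` (from the line of trivial solutions) on
`C^β_even(𝕋) × [0, ∞)`: it is a limit of nontrivial solutions. -/
def IsBifurcationPoint (α β μ₀ : ℝ) : Prop :=
  ((0 : HolderEven β), μ₀) ∈ closure (nontrivialSolutions α β)

end FKdV

end

/-! ### Abstract analytic bifurcation from a simple eigenvalue. -/

section CrandallRabinowitz

open scoped ContDiff
open Set Filter

variable {X : Type*} [NormedAddCommGroup X] [NormedSpace ℝ X]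

/-! With `μ = μ_k* + ν` the equation reads `T φ + ν φ - B φ φ = 0`, where `T = μ_k* - L` and `B` is
half the pointwise product. On even functions `L` is diagonal in the modes `cos (n x)`, and its
eigenvalues `m(n)` are pairwise distinct, so the kernel of `T` is spanned by `c = cos (k x)`. Adding
the projection onto `c` gives an isomorphism `A`.

Writing `φ = ε (c + ψ)` with `ψ` free of the mode `k` and dividing by `ε` leaves an analytic
equation `G (ε, w) = 0`. The unknowns `ψ` and `ν` are packed into one vector `w = ψ + ν c`, so that
the partial derivative of `G` in `w` at the origin is `A`. The implicit function theorem yields the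
analytic curve. Uniqueness in a full neighbourhood also needs the a priori bound
`eventually_norm_complement_le`: for a small solution `ψ` is automatically small, so the solution
lies on the curve. The period `2π/k` is inherited because a Newton-type iteration preserves the
closed subspace of such functions.

The analytic input is `norm_cosProj_le`: each projection onto a cosine mode is a convolution, hence
bounded on the Hölder space uniformly in `n`. As `α > 1` makes `m` summable, `L` is a
norm-convergent sum of projections. The inverse of `A` is a scalar plus another such sum, so no
kernel estimate or smoothing property is needed. -/

/-- The Crandall–Rabinowitz desingularization of `T φ + ν φ - B φ φ = 0`: with `A = T + ℓ ⊗ c` and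
`w = ψ + ν c`, `ℓ ψ = 0`, its value at `(ε, w)` is the left hand side at `φ = ε (c + ψ)`, divided
by `ε`. -/
noncomputable def desingularized (A : X ≃L[ℝ] X) (l : X →L[ℝ] ℝ) (c : X) (B : X →L[ℝ] X →L[ℝ] X)
    (p : ℝ × X) : X :=
  A p.2 + l p.2 • (p.2 - l p.2 • c) - p.1 • B (c + p.2 - l p.2 • c) (c + p.2 - l p.2 • c)

section

variable (A : X ≃L[ℝ] X) (l : X →L[ℝ] ℝ) (c : X) (B : X →L[ℝ] X →L[ℝ] X)

theorem desingularized_zero : desingularized A l c B 0 = 0 := by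
  simp [desingularized]

theorem contDiff_desingularized : ContDiff ℝ ω (desingularized A l c B) := by
  unfold desingularized
  have h1 : ContDiff ℝ ω fun p : ℝ × X => l p.2 := l.contDiff.comp contDiff_snd
  have h2 : ContDiff ℝ ω fun p : ℝ × X => p.2 - l p.2 • c :=
    contDiff_snd.sub (h1.smul contDiff_const)
  have h3 : ContDiff ℝ ω fun p : ℝ × X => c + p.2 - l p.2 • c :=
    (contDiff_const.add contDiff_snd).sub (h1.smul contDiff_const)
  exact ((A.contDiff.comp contDiff_snd).add (h1.smul h2)).sub
    (contDiff_fst.smul ((B.contDiff.comp h3).clm_apply h3))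

/-- Apart from `A w`, every term is either quadratic in `w` or carries a factor `ε`, so only `A`
survives at the origin. -/
theorem fderiv_desingularized_comp_inr :
    fderiv ℝ (desingularized A l c B) 0 ∘L .inr ℝ ℝ X = A := by
  have h1 : HasFDerivAt (desingularized A l c B) (fderiv ℝ (desingularized A l c B) 0)
      (ContinuousLinearMap.inr ℝ ℝ X 0) := by
    rw [map_zero]
    exact ((contDiff_desingularized A l c B).differentiable (by simp) 0).hasFDerivAt
  have h2 := h1.comp (0 : X) (ContinuousLinearMap.inr ℝ ℝ X).hasFDerivAt
  refine h2.unique ?_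
  have h3 : HasFDerivAt (fun w : X => A w + l w • (w - l w • c)) (A : X →L[ℝ] X) 0 := by
    have hl : HasFDerivAt (fun w : X => l w) l 0 := l.hasFDerivAt
    have := (A : X →L[ℝ] X).hasFDerivAt (x := 0) |>.add
      (hl.smul ((hasFDerivAt_id (𝕜 := ℝ) (0 : X)).sub (hl.smul_const c)))
    convert! this using 1
    ext w
    simp
  convert! h3 using 1
  ext w
  simp [desingularized]

/-- A zero set that is locally the graph of `W` over the parameter line takes its values in every
closed subspace that is invariant under the equation. -/
theorem eventually_mem_of_desingularized_eq_zero [CompleteSpace X] (Y : Submodule ℝ X)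
    (hY : IsClosed (Y : Set X)) (hc : c ∈ Y) (hA : ∀ f ∈ Y, A f ∈ Y) (hA' : ∀ f ∈ Y, A.symm f ∈ Y)
    (hB : ∀ f ∈ Y, B f f ∈ Y) (W : ℝ → X)
    (hW : ∀ᶠ p in 𝓝 (0 : ℝ × X), desingularized A l c B p = 0 → W p.1 = p.2) :
    ∀ᶠ ε in 𝓝 (0 : ℝ), W ε ∈ Y := by
  set G := desingularized A l c B with hG
  -- Newton map with the derivative frozen at `A`: its fixed points are the zeros of `G`, it
  -- preserves `Y`, and its `w`-derivative vanishes at the origin.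
  set N : ℝ × X → X := fun p => p.2 - A.symm (G p) with hN
  set D : ℝ × X →L[ℝ] X :=
    .snd ℝ ℝ X - (A.symm : X →L[ℝ] X) ∘L fderiv ℝ G 0 with hD
  have hGs : HasStrictFDerivAt G (fderiv ℝ G 0) 0 :=
    (contDiff_desingularized A l c B).contDiffAt.hasStrictFDerivAt (by simp)
  have hNs : HasStrictFDerivAt N D 0 :=
    hasStrictFDerivAt_snd.sub ((A.symm : X →L[ℝ] X).hasStrictFDerivAt.comp 0 hGs)
  have hD0 : ∀ w, D (0, w) = 0 := fun w => by
    have := DFunLike.congr_fun (fderiv_desingularized_comp_inr A l c B) w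
    simp only [ContinuousLinearMap.comp_apply, ContinuousLinearMap.inr_apply] at this
    simp [hD, hG, this]
  have hNY : ∀ ε, ∀ w ∈ Y, N (ε, w) ∈ Y := fun ε w hw => by
    have hq : c + w - l w • c ∈ Y := Y.sub_mem (Y.add_mem hc hw) (Y.smul_mem _ hc)
    exact Y.sub_mem hw (hA' _ (Y.sub_mem (Y.add_mem (hA _ hw)
      (Y.smul_mem _ (Y.sub_mem hw (Y.smul_mem _ hc)))) (Y.smul_mem _ (hB _ hq))))
  have hlip := hNs.isLittleO.def (c := 1 / 2) (by norm_num)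
  rw [show ((0 : ℝ × X), (0 : ℝ × X)) = 0 from rfl] at hlip
  obtain ⟨r₁, hr₁, h₁⟩ := Metric.eventually_nhds_iff.mp hlip
  obtain ⟨r₂, hr₂, h₂⟩ := Metric.eventually_nhds_iff.mp hW
  set r := min r₁ r₂ / 2 with hr
  have hr0 : 0 < r := by positivity
  have hrr : r < min r₁ r₂ := half_lt_self (by positivity)
  have hN0 : Tendsto (fun ε : ℝ => N (ε, 0)) (𝓝 0) (𝓝 0) := by
    have h : ContinuousAt N 0 := hNs.continuousAt
    have h' : ContinuousAt (fun ε : ℝ => N (ε, 0)) 0 :=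
      ContinuousAt.comp (f := fun ε : ℝ => (ε, (0 : X))) h (by fun_prop)
    have e : N (0, 0) = 0 := by
      have := desingularized_zero A l c B
      simp only [hN, hG]
      rw [show ((0 : ℝ), (0 : X)) = 0 from rfl, this]
      simp
    simpa [ContinuousAt, e] using h'
  have hsmall : ∀ᶠ ε in 𝓝 (0 : ℝ), ‖N (ε, 0)‖ < r / 2 := by
    have := (Metric.tendsto_nhds.mp hN0) (r / 2) (by positivity)
    simpa using this
  filter_upwards [hsmall, Metric.ball_mem_nhds (0 : ℝ) hr0] with ε hε hεr
  have hεr' : ‖ε‖ < r := by simpa using hεr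
  have hcontr : ∀ w ∈ Metric.closedBall (0 : X) r, ∀ w' ∈ Metric.closedBall (0 : X) r,
      ‖N (ε, w) - N (ε, w')‖ ≤ 1 / 2 * ‖w - w'‖ := by
    intro w hw w' hw'
    rw [mem_closedBall_zero_iff] at hw hw'
    have := @h₁ ((ε, w), (ε, w')) (by
      rw [dist_zero_right]
      simp only [Prod.norm_def]
      have := lt_of_lt_of_le hrr (min_le_left _ _)
      simp only [sup_lt_iff]
      refine ⟨⟨?_, ?_⟩, ?_, ?_⟩ <;> linarith)
    simpa [hD0, Prod.norm_def] using this
  -- A contraction of the complete set `s` has a fixed point in `Y`; local uniqueness of zeros then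
  -- identifies it with `W ε`.
  set s : Set X := Metric.closedBall 0 r ∩ Y with hs
  have hmaps : MapsTo (fun w => N (ε, w)) s s := by
    rintro w ⟨hw, hwY⟩
    refine ⟨?_, hNY ε w hwY⟩
    have h := hcontr w hw 0 (by simp [hr0.le])
    rw [mem_closedBall_zero_iff] at hw ⊢
    have := norm_le_norm_sub_add (N (ε, w)) (N (ε, 0))
    rw [sub_zero] at h
    linarith
  have hcw : ContractingWith (1 / 2) (hmaps.restrict (fun w => N (ε, w)) s s) := by
    refine ⟨by rw [← NNReal.coe_lt_coe]; norm_num, LipschitzWith.of_dist_le_mul fun x y => ?_⟩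
    have := hcontr x x.2.1 y y.2.1
    simpa [Subtype.dist_eq, dist_eq_norm] using this
  obtain ⟨w, ⟨hw, hwY⟩, hfix, -⟩ := hcw.exists_fixedPoint'
    (Metric.isClosed_closedBall.inter hY).isComplete hmaps
    (x := 0) ⟨by simp [hr0.le], Y.zero_mem⟩ (edist_ne_top _ _)
  have hGw : G (ε, w) = 0 := by
    have : w - A.symm (G (ε, w)) = w := hfix
    simpa using this
  have := @h₂ (ε, w) (by
    rw [mem_closedBall_zero_iff] at hw
    rw [dist_zero_right, Prod.norm_def]
    have := lt_of_lt_of_le hrr (min_le_right _ _)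
    simp only [sup_lt_iff]
    constructor <;> linarith) hGw
  rw [this]
  exact hwY

end

/-- Small nontrivial solutions of `T φ + ν φ - B φ φ = 0` are of the form `φ = ε (c + ψ)` with
`ε = ℓ φ ≠ 0` and `ψ` small. -/
theorem eventually_norm_complement_le (A : X ≃L[ℝ] X) (T : X →L[ℝ] X) (l : X →L[ℝ] ℝ) (c : X)
    (B : X →L[ℝ] X →L[ℝ] X) (hA : ∀ w, A w = T w + l w • c) (hTc : T c = 0)
    (hlT : ∀ w, l (T w) = 0) (hlc : l c = 1) :
    ∃ C : ℝ, ∀ᶠ p in 𝓝 (0 : X × ℝ), T p.1 + p.2 • p.1 - B p.1 p.1 = 0 →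
      ‖p.1 - l p.1 • c‖ ≤ C * ‖p.1‖ * |l p.1| := by
  set K := ‖(A.symm : X →L[ℝ] X)‖ with hK
  have hK0 : 0 ≤ K := norm_nonneg _
  -- The factor 2 pays for absorbing `K |ν| ‖χ‖ ≤ ‖χ‖ / 2` into the left side; the 2 in the final
  -- constant comes from absorbing `M ‖φ‖ ‖χ‖` likewise.
  set M := 2 * K * (‖B‖ + ‖l‖ * ‖B‖ * ‖c‖) with hM
  have hM0 : 0 ≤ M := by positivity
  refine ⟨2 * M * ‖c‖, ?_⟩
  have h1 : ∀ᶠ p in 𝓝 (0 : X × ℝ), K * |p.2| < 1 / 2 := by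
    have : ContinuousAt (fun p : X × ℝ => K * |p.2|) 0 := by fun_prop
    exact this.eventually_lt continuousAt_const (by simp)
  have h2 : ∀ᶠ p in 𝓝 (0 : X × ℝ), M * ‖p.1‖ < 1 / 2 := by
    have : ContinuousAt (fun p : X × ℝ => M * ‖p.1‖) 0 := by fun_prop
    exact this.eventually_lt continuousAt_const (by simp)
  filter_upwards [h1, h2]
  rintro ⟨φ, ν⟩ h1 h2 heq
  simp only at h1 h2 heq ⊢
  set ε := l φ with hε
  set χ := φ - ε • c with hχ
  have hlχ : l χ = 0 := by simp [hχ, hlc, hε]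
  -- Applying `l` to the equation kills `T` and gives the scalar part of the Lyapunov–Schmidt
  -- splitting.
  have hνε : ν * ε = l (B φ φ) := by
    have := congrArg l heq
    simp only [map_sub, map_add, hlT, map_smul, map_zero, smul_eq_mul] at this
    linarith
  have hAχ : A χ = B φ φ - (l (B φ φ)) • c - ν • χ := by
    rw [hA, hlχ, ← hνε]
    have : T χ = T φ := by simp [hχ, hTc]
    rw [this, eq_sub_of_add_eq (sub_eq_zero.mp heq), hχ]
    module
  have hbφ : ‖B φ φ‖ ≤ ‖B‖ * ‖φ‖ * ‖φ‖ := B.le_opNorm₂ φ φ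
  have hlb : |l (B φ φ)| ≤ ‖l‖ * (‖B‖ * ‖φ‖ * ‖φ‖) :=
    (l.le_opNorm _).trans (by gcongr)
  have e1 : ‖χ‖ ≤ K * ‖A χ‖ := by
    have := (A.symm : X →L[ℝ] X).le_opNorm (A χ)
    simpa using this
  have e2 : ‖A χ‖ ≤ ‖B‖ * ‖φ‖ * ‖φ‖ + ‖l‖ * (‖B‖ * ‖φ‖ * ‖φ‖) * ‖c‖ + |ν| * ‖χ‖ := by
    rw [hAχ]
    refine (norm_sub_le _ _).trans (add_le_add ((norm_sub_le _ _).trans (add_le_add hbφ ?_)) ?_)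
    · rw [norm_smul]
      exact mul_le_mul_of_nonneg_right hlb (norm_nonneg _)
    · rw [norm_smul, Real.norm_eq_abs]
  have e3 : ‖χ‖ ≤ M * ‖φ‖ * ‖φ‖ := by
    have h3 : K * |ν| * ‖χ‖ ≤ 1 / 2 * ‖χ‖ := mul_le_mul_of_nonneg_right h1.le (norm_nonneg _)
    have h4 := e1.trans (mul_le_mul_of_nonneg_left e2 hK0)
    rw [hM]
    nlinarith
  have e4 : ‖φ‖ ≤ |ε| * ‖c‖ + ‖χ‖ := by
    have : φ = ε • c + χ := by rw [hχ]; abel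
    calc ‖φ‖ = ‖ε • c + χ‖ := by rw [← this]
      _ ≤ _ := (norm_add_le _ _).trans (by rw [norm_smul, Real.norm_eq_abs])
  have e5 : ‖χ‖ ≤ M * ‖φ‖ * (|ε| * ‖c‖ + ‖χ‖) :=
    e3.trans (mul_le_mul_of_nonneg_left e4 (by positivity))
  have e6 : M * ‖φ‖ * ‖χ‖ ≤ 1 / 2 * ‖χ‖ := mul_le_mul_of_nonneg_right h2.le (norm_nonneg _)
  nlinarith

/-- Analytic bifurcation from a simple eigenvalue (Crandall–Rabinowitz) for the quadratic equation
`T φ + ν φ - B φ φ = 0`, where `c` spans the kernel of `T`; the bifurcating solutions lie in every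
closed invariant subspace `Y` that contains `c`. -/
theorem exists_analytic_bifurcation [CompleteSpace X] (A : X ≃L[ℝ] X) (T : X →L[ℝ] X)
    (l : X →L[ℝ] ℝ) (c : X) (B : X →L[ℝ] X →L[ℝ] X) (hA : ∀ w, A w = T w + l w • c)
    (hTc : T c = 0) (hlT : ∀ w, l (T w) = 0) (hlc : l c = 1) (Y : Submodule ℝ X)
    (hY : IsClosed (Y : Set X)) (hc : c ∈ Y) (hTY : ∀ f ∈ Y, T f ∈ Y)
    (hAY : ∀ f ∈ Y, A.symm f ∈ Y) (hB : ∀ f ∈ Y, B f f ∈ Y) {V : Set ℝ} (hV : V ∈ 𝓝 (0 : ℝ)) :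
    ∃ ε₀ : ℝ, 0 < ε₀ ∧ ∃ (φ : ℝ → X) (ν : ℝ → ℝ),
      AnalyticOnNhd ℝ φ (Ioo (-ε₀) ε₀) ∧ AnalyticOnNhd ℝ ν (Ioo (-ε₀) ε₀) ∧ φ 0 = 0 ∧ ν 0 = 0 ∧
      (∀ ε ∈ Ioo (-ε₀) ε₀, T (φ ε) + ν ε • φ ε - B (φ ε) (φ ε) = 0 ∧ φ ε ∈ Y ∧ l (φ ε) = ε ∧
        ν ε ∈ V) ∧
      HasDerivAt φ c 0 ∧
      ∃ U ∈ 𝓝 (0 : X × ℝ), ∀ p ∈ U, T p.1 + p.2 • p.1 - B p.1 p.1 = 0 → p.1 ≠ 0 →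
        ∃ ε ∈ Ioo (-ε₀) ε₀, ε ≠ 0 ∧ p = (φ ε, ν ε) := by
  set G := desingularized A l c B with hG
  have hGc : ContDiffAt ℝ ω G 0 := (contDiff_desingularized A l c B).contDiffAt
  have hG0 : G 0 = 0 := desingularized_zero A l c B
  have hinv : (fderiv ℝ G 0 ∘L .inr ℝ ℝ X).IsInvertible := by
    rw [hG, fderiv_desingularized_comp_inr]
    exact ⟨A, rfl⟩
  have hω : (ω : WithTop ℕ∞) ≠ 0 := by simp
  set W := hGc.implicitFunction hω hinv with hW
  have hW0 : W 0 = 0 := hGc.implicitFunction_apply_self hω hinv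
  have hWa : AnalyticAt ℝ W 0 := (hGc.contDiffAt_implicitFunction hω hinv).analyticAt
  have hGW : ∀ᶠ ε in 𝓝 (0 : ℝ), G (ε, W ε) = 0 := by
    have := hGc.eventually_apply_implicitFunction hω hinv
    rwa [hG0] at this
  have hiff : ∀ᶠ p in 𝓝 (0 : ℝ × X), G p = 0 → W p.1 = p.2 := by
    filter_upwards [hGc.eventually_apply_eq_iff_implicitFunction hω hinv] with p hp h
    exact hp.mp (h.trans hG0.symm)
  have hWY := eventually_mem_of_desingularized_eq_zero A l c B Y hY hc
    (fun f hf => by rw [hA]; exact Y.add_mem (hTY f hf) (Y.smul_mem _ hc)) hAY hB W hiff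
  have hWV : ∀ᶠ ε in 𝓝 (0 : ℝ), l (W ε) ∈ V := by
    have : ContinuousAt (fun ε => l (W ε)) 0 := l.continuous.continuousAt.comp hWa.continuousAt
    refine this.eventually_mem ?_
    simpa [hW0] using hV
  obtain ⟨ε₀, hε₀, hball⟩ := Metric.eventually_nhds_iff.mp
    (hGW.and (hWY.and (hWV.and hWa.eventually_analyticAt)))
  have hgood : ∀ ε ∈ Ioo (-ε₀) ε₀, G (ε, W ε) = 0 ∧ W ε ∈ Y ∧ l (W ε) ∈ V ∧ AnalyticAt ℝ W ε :=
    fun ε hε => hball (by rw [dist_zero_right, Real.norm_eq_abs]; exact abs_lt.mpr hε)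
  set φ : ℝ → X := fun ε => ε • (c + W ε - l (W ε) • c) with hφ
  set ν : ℝ → ℝ := fun ε => l (W ε) with hν
  have hνa : AnalyticOnNhd ℝ ν (Ioo (-ε₀) ε₀) := fun ε hε =>
    (l.analyticAt _).comp (hgood ε hε).2.2.2
  have hqa : ∀ ε ∈ Ioo (-ε₀) ε₀, AnalyticAt ℝ (fun ε => c + W ε - l (W ε) • c) ε := fun ε hε =>
    (analyticAt_const.add (hgood ε hε).2.2.2).sub ((hνa ε hε).smul analyticAt_const)
  have h0 : (0 : ℝ) ∈ Ioo (-ε₀) ε₀ := ⟨by linarith, hε₀⟩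
  obtain ⟨C, hC⟩ := eventually_norm_complement_le A T l c B hA hTc hlT hlc
  obtain ⟨r, hr, hr'⟩ := Metric.eventually_nhds_iff.mp hiff
  -- These bounds place the rescaled pair `(ε, w)` in the ball of radius `r` where all zeros of `G`
  -- lie on the graph of `W`.
  have hU1 : ∀ᶠ p in 𝓝 (0 : X × ℝ), |l p.1| < min ε₀ r := by
    have : ContinuousAt (fun p : X × ℝ => |l p.1|) 0 := by fun_prop
    exact this.eventually_lt continuousAt_const (by simp [hε₀, hr])
  have hU2 : ∀ᶠ p in 𝓝 (0 : X × ℝ), C * ‖p.1‖ + |p.2| * ‖c‖ < r := by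
    have : ContinuousAt (fun p : X × ℝ => C * ‖p.1‖ + |p.2| * ‖c‖) 0 := by fun_prop
    exact this.eventually_lt continuousAt_const (by simp [hr])
  refine ⟨ε₀, hε₀, φ, ν, fun ε hε => analyticAt_id.smul (hqa ε hε), hνa, by simp [hφ],
    by simp [hν, hW0], fun ε hε => ⟨?_, ?_, ?_, (hgood ε hε).2.2.1⟩, ?_, _,
    hC.and (hU1.and hU2), ?_⟩
  · have h := (hgood ε hε).1
    simp only [hG, desingularized, hA] at h
    have h' := congrArg (fun z => ε • z) h
    simp only [smul_zero] at h'
    rw [← h']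
    simp only [hφ, hν, map_smul, map_add, map_sub, hTc, _root_.smul_apply,
      _root_.add_apply, _root_.sub_apply]
    module
  · exact Y.smul_mem _ (Y.sub_mem (Y.add_mem hc (hgood ε hε).2.1) (Y.smul_mem _ hc))
  · simp [hφ, hlc]
  · have := (hasDerivAt_id (0 : ℝ)).smul (hqa 0 h0).differentiableAt.hasDerivAt
    convert! this using 1
    simp [hW0]
  · rintro ⟨f, μ⟩ ⟨h1, h2, h3⟩ heq hne
    simp only at h1 h2 h3 heq hne
    specialize h1 heq
    set ε := l f with hε
    -- If `ε = 0`, the bound on the complement forces the solution itself to vanish.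
    have hε0 : ε ≠ 0 := by
      intro h
      rw [h] at h1
      simp at h1
      exact hne h1
    have hεI : ε ∈ Ioo (-ε₀) ε₀ := abs_lt.mp (h2.trans_le (min_le_left _ _))
    -- Inverse of the substitution `f = ε (c + w - l w • c)` with `l w = μ`.
    set w := ε⁻¹ • (f - ε • c) + μ • c with hw
    have hlw : l w = μ := by simp [hw, ← hε, hlc]
    have hwn : ‖w‖ ≤ C * ‖f‖ + |μ| * ‖c‖ := by
      refine (norm_add_le _ _).trans ?_
      rw [norm_smul, norm_smul, Real.norm_eq_abs, Real.norm_eq_abs, abs_inv]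
      refine add_le_add_left ?_ _
      rw [inv_mul_le_iff₀ (abs_pos.mpr hε0)]
      linarith
    have hq : c + w - l w • c = ε⁻¹ • f := by
      rw [hlw, hw, smul_sub, inv_smul_smul₀ hε0]
      abel
    have hGw : G (ε, w) = 0 := by
      have e1 : T f = B f f - μ • f := eq_sub_of_add_eq (sub_eq_zero.mp heq)
      have e2 : A w = ε⁻¹ • T f + μ • c := by
        rw [hA, hlw, hw]
        simp [hTc]
      have e3 : w - l w • c = ε⁻¹ • f - c := by rw [← hq]; abel
      simp only [hG, desingularized]
      rw [hq, e3, e2, e1, hlw]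
      simp only [map_smul, _root_.smul_apply]
      rw [smul_inv_smul₀ hε0]
      module
    have hWw : W ε = w := @hr' (ε, w) (by
      rw [dist_zero_right, Prod.norm_def, Real.norm_eq_abs]
      exact max_lt (h2.trans_le (min_le_right _ _)) (hwn.trans_lt h3)) hGw
    refine ⟨ε, hεI, hε0, ?_⟩
    simp only [hφ, hν]
    rw [hWw, hq, smul_inv_smul₀ hε0, hlw]

end CrandallRabinowitz

/-! ### The Hölder space: completeness and multiplication. -/

noncomputable section

namespace FKdV

namespace HolderEven

open Filter

variable {β : ℝ}

theorem holderWith_of_abs_sub_le {C r : ℝ≥0} {g : ℝ → ℝ}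
    (h : ∀ x y, |g x - g y| ≤ C * |x - y| ^ (r : ℝ)) : HolderWith C r g := fun x y => by
  rw [edist_dist, edist_dist, ENNReal.ofReal_rpow_of_nonneg dist_nonneg r.coe_nonneg,
    ← ENNReal.ofReal_coe_nnreal, ← ENNReal.ofReal_mul C.coe_nonneg]
  exact ENNReal.ofReal_le_ofReal (h x y)

theorem abs_apply_le_norm (f : HolderEven β) (x : ℝ) : |f x| ≤ ‖f‖ := by
  have h : |f x| ≤ supNorm f := le_ciSup f.bddAbove_coe x
  have h2 := supNorm_nonneg (deriv f)
  rw [norm_def]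
  have := NNReal.coe_nonneg (nnHolderNorm (β - 1).toNNReal (deriv f))
  linarith

theorem abs_deriv_le_norm (f : HolderEven β) (x : ℝ) : |deriv f x| ≤ ‖f‖ := by
  have h : |deriv f x| ≤ supNorm (deriv f) := le_ciSup f.bddAbove_deriv x
  have h2 := supNorm_nonneg f
  rw [norm_def]
  have := NNReal.coe_nonneg (nnHolderNorm (β - 1).toNNReal (deriv f))
  linarith

theorem abs_deriv_sub_le_norm (f : HolderEven β) (x y : ℝ) :
    |deriv f x - deriv f y| ≤ ‖f‖ * |x - y| ^ ((β - 1).toNNReal : ℝ) := by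
  have h := f.mem.2.2.2.holderWith.dist_le x y
  rw [Real.dist_eq, Real.dist_eq] at h
  refine h.trans (mul_le_mul_of_nonneg_right ?_ (by positivity))
  have h1 := supNorm_nonneg f
  have h2 := supNorm_nonneg (deriv f)
  rw [norm_def]
  linarith

theorem norm_le {f : HolderEven β} {a b c : ℝ} (hc : 0 ≤ c) (h0 : ∀ x, |f x| ≤ a)
    (h1 : ∀ x, |deriv f x| ≤ b)
    (h2 : ∀ x y, |deriv f x - deriv f y| ≤ c * |x - y| ^ ((β - 1).toNNReal : ℝ)) :
    ‖f‖ ≤ a + b + c := by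
  lift c to ℝ≥0 using hc
  have h3 : (nnHolderNorm (β - 1).toNNReal (deriv f) : ℝ) ≤ c :=
    NNReal.coe_le_coe.mpr (holderWith_of_abs_sub_le h2).nnholderNorm_le
  have h4 : supNorm f ≤ a := ciSup_le h0
  have h5 : supNorm (deriv f) ≤ b := ciSup_le h1
  rw [norm_def]
  linarith

theorem mem_holderEvenSubmodule {f g : ℝ → ℝ} {c : ℝ} (hp : Function.Periodic f (2 * Real.pi))
    (he : Function.Even f) (hfg : ∀ x, HasDerivAt f (g x) x) (hg : Continuous g) (hc : 0 ≤ c)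
    (h : ∀ x y, |g x - g y| ≤ c * |x - y| ^ ((β - 1).toNNReal : ℝ)) :
    f ∈ holderEvenSubmodule β := by
  lift c to ℝ≥0 using hc
  have hd : deriv f = g := funext fun x => (hfg x).deriv
  refine ⟨hp, he, ?_, ?_⟩
  · rw [contDiff_one_iff_deriv, hd]
    exact ⟨fun x => (hfg x).differentiableAt, hg⟩
  · rw [hd]
    exact (holderWith_of_abs_sub_le h).memHolder

theorem continuous_deriv (f : HolderEven β) : Continuous (deriv f) :=
  f.mem.2.2.1.continuous_deriv le_rfl

theorem continuous_coe (f : HolderEven β) : Continuous f := f.mem.2.2.1.continuous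

theorem hasDerivAt (f : HolderEven β) (x : ℝ) : HasDerivAt f (deriv f x) x :=
  (f.differentiable x).hasDerivAt

theorem deriv_neg_apply (f : HolderEven β) (x : ℝ) : deriv f (-x) = -deriv f x := by
  have h : (fun y => f (-y)) = f := funext f.mem.2.1
  have := deriv_comp_neg (f := f) (x := x)
  rw [h] at this
  linarith

theorem periodic_deriv (f : HolderEven β) : Function.Periodic (deriv f) (2 * Real.pi) := fun x => by
  have h : (fun y => f (y + 2 * Real.pi)) = f := funext f.mem.1
  rw [← deriv_comp_add_const, h]

theorem coe_sub (f g : HolderEven β) : ((f - g : HolderEven β) : ℝ → ℝ) = ⇑f - ⇑g := rfl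

theorem deriv_coe_sub (f g : HolderEven β) :
    deriv (f - g : HolderEven β) = deriv f - deriv g := by
  funext x
  exact deriv_sub (f.differentiable x) (g.differentiable x)

theorem abs_sub_apply_le (f g : HolderEven β) (x : ℝ) : |f x - g x| ≤ ‖f - g‖ :=
  abs_apply_le_norm (f - g) x

theorem abs_deriv_sub_deriv_le (f g : HolderEven β) (x : ℝ) :
    |deriv f x - deriv g x| ≤ ‖f - g‖ := by
  have := abs_deriv_le_norm (f - g) x
  rwa [deriv_coe_sub] at this

/-- Derivatives of a Cauchy sequence converge uniformly, so the pointwise limit is differentiable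
with the expected derivative. Hölder bounds pass to pointwise limits, which gives both membership
and norm convergence. -/
instance : CompleteSpace (HolderEven β) := by
  refine Metric.complete_of_cauchySeq_tendsto fun u hu => ?_
  have h0 : ∀ x, ∃ y, Tendsto (fun n => u n x) atTop (𝓝 y) := fun x =>
    cauchySeq_tendsto_of_complete (UniformContinuous.comp_cauchySeq
      (f := fun f : HolderEven β => f x)
      (LipschitzWith.of_dist_le_mul (K := 1) fun f g => by
        rw [NNReal.coe_one, one_mul, Real.dist_eq, dist_eq_norm]
        exact abs_sub_apply_le _ _ x).uniformContinuous hu)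
  have h1 : ∀ x, ∃ y, Tendsto (fun n => deriv (u n) x) atTop (𝓝 y) := fun x =>
    cauchySeq_tendsto_of_complete (UniformContinuous.comp_cauchySeq
      (f := fun f : HolderEven β => deriv f x)
      (LipschitzWith.of_dist_le_mul (K := 1) fun f g => by
        rw [NNReal.coe_one, one_mul, Real.dist_eq, dist_eq_norm]
        exact abs_deriv_sub_deriv_le _ _ x).uniformContinuous hu)
  choose f hf using h0
  choose g hg using h1
  have hunif : TendstoUniformly (fun n => deriv (u n)) g atTop := by
    rw [Metric.tendstoUniformly_iff]
    intro ε hε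
    obtain ⟨N, hN⟩ := Metric.cauchySeq_iff.mp hu (ε / 2) (half_pos hε)
    filter_upwards [eventually_ge_atTop N] with n hn x
    have : |g x - deriv (u n) x| ≤ ε / 2 := by
      refine le_of_tendsto ((hg x).sub_const _).abs ?_
      filter_upwards [eventually_ge_atTop N] with m hm
      refine (abs_deriv_sub_deriv_le _ _ x).trans ?_
      rw [← dist_eq_norm]
      exact (hN m hm n hn).le
    rw [Real.dist_eq]
    linarith
  have hfg : ∀ x, HasDerivAt f (g x) x :=
    hasDerivAt_of_tendstoUniformly hunif (Eventually.of_forall fun n x => (u n).hasDerivAt x) hf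
  have hgc : Continuous g :=
    hunif.continuous (Frequently.of_forall fun n => (u n).continuous_deriv)
  obtain ⟨R, hR⟩ := hu.isBounded_range.exists_norm_le
  have hRn : ∀ n, ‖u n‖ ≤ R := fun n => hR _ ⟨n, rfl⟩
  have hR0 : 0 ≤ R := (norm_nonneg _).trans (hRn 0)
  have hH : ∀ x y, |g x - g y| ≤ R * |x - y| ^ ((β - 1).toNNReal : ℝ) := fun x y =>
    le_of_tendsto ((hg x).sub (hg y)).abs (Eventually.of_forall fun n =>
      ((u n).abs_deriv_sub_le_norm x y).trans
        (mul_le_mul_of_nonneg_right (hRn n) (by positivity)))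
  have hp : Function.Periodic f (2 * Real.pi) := fun x =>
    tendsto_nhds_unique (hf _) ((hf x).congr fun n => ((u n).mem.1 x).symm)
  have he : Function.Even f := fun x =>
    tendsto_nhds_unique (hf _) ((hf x).congr fun n => ((u n).mem.2.1 x).symm)
  let v : HolderEven β := ⟨f, mem_holderEvenSubmodule hp he hfg hgc hR0 hH⟩
  have hv : ∀ x, v x = f x := fun _ => rfl
  have hdv : deriv v = g := funext fun x => (hfg x).deriv
  refine ⟨v, ?_⟩
  rw [Metric.tendsto_atTop]
  intro ε hε
  obtain ⟨N, hN⟩ := Metric.cauchySeq_iff.mp hu (ε / 6) (by positivity)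
  refine ⟨N, fun n hn => ?_⟩
  have hmn : ∀ m ≥ N, ‖u n - u m‖ ≤ ε / 6 := fun m hm => by
    rw [← dist_eq_norm]
    exact (hN n hn m hm).le
  have key : ‖u n - v‖ ≤ ε / 6 + ε / 6 + ε / 6 := by
    refine norm_le (by positivity) (fun x => ?_) (fun x => ?_) fun x y => ?_
    · refine le_of_tendsto ((hf x).const_sub (u n x)).abs ?_
      filter_upwards [eventually_ge_atTop N] with m hm
      exact (abs_sub_apply_le _ _ x).trans (hmn m hm)
    · rw [deriv_coe_sub, hdv]
      refine le_of_tendsto ((hg x).const_sub (deriv (u n) x)).abs ?_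
      filter_upwards [eventually_ge_atTop N] with m hm
      exact (abs_deriv_sub_deriv_le _ _ x).trans (hmn m hm)
    · rw [deriv_coe_sub, hdv]
      refine le_of_tendsto
        (((hg x).const_sub (deriv (u n) x)).sub ((hg y).const_sub (deriv (u n) y))).abs ?_
      filter_upwards [eventually_ge_atTop N] with m hm
      have := abs_deriv_sub_le_norm (u n - u m) x y
      rw [deriv_coe_sub] at this
      exact this.trans (mul_le_mul_of_nonneg_right (hmn m hm) (by positivity))
  rw [dist_eq_norm]
  linarith

theorem toNNReal_sub_one_le (hβ : β ≤ 2) : ((β - 1).toNNReal : ℝ) ≤ 1 := by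
  rw [Real.coe_toNNReal']
  exact max_le (by linarith) zero_le_one

/-- A bounded Lipschitz function is Hölder continuous of every exponent at most one. -/
theorem abs_sub_le_mul_rpow {g : ℝ → ℝ} {a r x y : ℝ} (hr : 0 ≤ r) (hr1 : r ≤ 1)
    (ha : 0 ≤ a) (h1 : |g x - g y| ≤ a * |x - y|) (h2 : |g x - g y| ≤ a) :
    |g x - g y| ≤ a * |x - y| ^ r := by
  rcases le_total |x - y| 1 with h | h
  · refine h1.trans (mul_le_mul_of_nonneg_left ?_ ha)
    rcases (abs_nonneg (x - y)).eq_or_lt with h0 | h0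
    · rw [← h0]
      positivity
    · simpa using Real.rpow_le_rpow_of_exponent_ge h0 h hr1
  · exact h2.trans (le_mul_of_one_le_right ha (Real.one_le_rpow h hr))

theorem abs_apply_sub_le (f : HolderEven β) (x y : ℝ) : |f x - f y| ≤ ‖f‖ * |x - y| := by
  have := Convex.norm_image_sub_le_of_norm_deriv_le (f := f) (s := Set.univ) (C := ‖f‖)
    (fun x _ => f.differentiable x) (fun x _ => abs_deriv_le_norm f x) convex_univ
    (Set.mem_univ y) (Set.mem_univ x)
  simpa using this

theorem abs_apply_sub_le_rpow (hβ : β ≤ 2) (f : HolderEven β) (x y : ℝ) :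
    |f x - f y| ≤ 2 * ‖f‖ * |x - y| ^ ((β - 1).toNNReal : ℝ) := by
  have h0 := norm_nonneg f
  refine abs_sub_le_mul_rpow (NNReal.coe_nonneg _) (toNNReal_sub_one_le hβ) (by positivity) ?_ ?_
  · refine (f.abs_apply_sub_le x y).trans (mul_le_mul_of_nonneg_right ?_ (abs_nonneg _))
    linarith
  · refine (abs_sub _ _).trans ?_
    linarith [f.abs_apply_le_norm x, f.abs_apply_le_norm y]

/-- `f' g` is Hölder continuous. -/
theorem abs_deriv_mul_sub_le (hβ : β ≤ 2) (f g : HolderEven β) (x y : ℝ) :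
    |deriv f x * g x - deriv f y * g y| ≤
      3 * ‖f‖ * ‖g‖ * |x - y| ^ ((β - 1).toNNReal : ℝ) := by
  have e : deriv f x * g x - deriv f y * g y =
      (deriv f x - deriv f y) * g x + deriv f y * (g x - g y) := by ring
  rw [e]
  refine (abs_add_le _ _).trans ?_
  rw [abs_mul, abs_mul]
  have h1 := mul_le_mul (f.abs_deriv_sub_le_norm x y) (g.abs_apply_le_norm x) (abs_nonneg _)
    (by positivity)
  have h2 := mul_le_mul (f.abs_deriv_le_norm y) (g.abs_apply_sub_le_rpow hβ x y) (abs_nonneg _)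
    (by positivity)
  linarith

theorem hasDerivAt_mul (f g : HolderEven β) (x : ℝ) :
    HasDerivAt (fun x => f x * g x) (deriv f x * g x + deriv g x * f x) x := by
  have := (f.hasDerivAt x).mul (g.hasDerivAt x)
  rwa [mul_comm (f x)] at this

theorem abs_deriv_mul_add_sub_le (hβ : β ≤ 2) (f g : HolderEven β) (x y : ℝ) :
    |(deriv f x * g x + deriv g x * f x) - (deriv f y * g y + deriv g y * f y)| ≤
      6 * ‖f‖ * ‖g‖ * |x - y| ^ ((β - 1).toNNReal : ℝ) := by
  have h1 := f.abs_deriv_mul_sub_le hβ g x y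
  have h2 := g.abs_deriv_mul_sub_le hβ f x y
  rw [add_sub_add_comm]
  refine (abs_add_le _ _).trans ?_
  linarith

/-- Pointwise multiplication. -/
def mul (hβ : β ≤ 2) (f g : HolderEven β) : HolderEven β :=
  ⟨fun x => f x * g x, mem_holderEvenSubmodule (c := 6 * ‖f‖ * ‖g‖)
    (fun x => by simp only [f.mem.1 x, g.mem.1 x])
    (fun x => by simp only [f.mem.2.1 x, g.mem.2.1 x])
    (f.hasDerivAt_mul g)
    ((f.continuous_deriv.mul g.continuous_coe).add (g.continuous_deriv.mul f.continuous_coe))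
    (by positivity) (f.abs_deriv_mul_add_sub_le hβ g)⟩

theorem mul_apply (hβ : β ≤ 2) (f g : HolderEven β) (x : ℝ) : mul hβ f g x = f x * g x := rfl

/-- The constant is `1 + 2 + 6`: sup norm, derivative by the product rule, Hölder seminorm. -/
theorem norm_mul_le (hβ : β ≤ 2) (f g : HolderEven β) : ‖mul hβ f g‖ ≤ 9 * ‖f‖ * ‖g‖ := by
  have hd : deriv (mul hβ f g) = fun x => deriv f x * g x + deriv g x * f x :=
    funext fun x => (f.hasDerivAt_mul g x).deriv
  have hm : ∀ {a b : ℝ} (p q : HolderEven β), |a| ≤ ‖p‖ → |b| ≤ ‖q‖ → |a * b| ≤ ‖p‖ * ‖q‖ :=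
    fun p q ha hb => by
      rw [abs_mul]
      exact mul_le_mul ha hb (abs_nonneg _) (norm_nonneg _)
  have := norm_le (f := mul hβ f g) (a := ‖f‖ * ‖g‖) (b := 2 * ‖f‖ * ‖g‖) (c := 6 * ‖f‖ * ‖g‖)
    (by positivity) (fun x => hm f g (f.abs_apply_le_norm x) (g.abs_apply_le_norm x))
    (fun x => by
      rw [hd]
      refine (abs_add_le _ _).trans ?_
      linarith [hm f g (f.abs_deriv_le_norm x) (g.abs_apply_le_norm x),
        hm g f (g.abs_deriv_le_norm x) (f.abs_apply_le_norm x)])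
    (fun x y => by rw [hd]; exact f.abs_deriv_mul_add_sub_le hβ g x y)
  linarith

/-- Pointwise multiplication as a continuous bilinear map. -/
def mulL (hβ : β ≤ 2) : HolderEven β →L[ℝ] HolderEven β →L[ℝ] HolderEven β :=
  LinearMap.mkContinuous₂ (LinearMap.mk₂ ℝ (mul hβ)
    (fun f g h => ext fun x => by simp only [mul_apply, coe_add, Pi.add_apply]; ring)
    (fun c f g => ext fun x => by simp only [mul_apply, coe_smul, Pi.smul_apply, smul_eq_mul]; ring)
    (fun f g h => ext fun x => by simp only [mul_apply, coe_add, Pi.add_apply]; ring)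
    (fun c f g => ext fun x => by simp only [mul_apply, coe_smul, Pi.smul_apply, smul_eq_mul]; ring))
    9 (norm_mul_le hβ)

theorem mulL_apply (hβ : β ≤ 2) (f g : HolderEven β) (x : ℝ) : mulL hβ f g x = f x * g x := rfl

/-- Evaluation at a point. -/
def evalL (x : ℝ) : HolderEven β →L[ℝ] ℝ :=
  LinearMap.mkContinuous ⟨⟨fun f => f x, fun _ _ => rfl⟩, fun _ _ => rfl⟩ 1 fun f => by
    rw [one_mul]
    exact f.abs_apply_le_norm x

/-- The functions of period `p` in `C^β_even(𝕋)`. -/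
def periodicSubmodule (β p : ℝ) : Submodule ℝ (HolderEven β) where
  carrier := {f | Function.Periodic f p}
  add_mem' hf hg := hf.add hg
  zero_mem' _ := rfl
  smul_mem' c f hf x := by simp only [coe_smul, Pi.smul_apply, hf x]

theorem isClosed_periodicSubmodule (p : ℝ) :
    IsClosed (periodicSubmodule β p : Set (HolderEven β)) := by
  have : (periodicSubmodule β p : Set (HolderEven β)) =
      ⋂ x, {f | evalL (β := β) (x + p) f = evalL x f} := by
    ext f
    simp only [Set.mem_iInter]
    rfl
  rw [this]
  exact isClosed_iInter fun x =>
    isClosed_eq (evalL (x + p)).continuous (evalL x).continuous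

end HolderEven

end FKdV

end

/-! ### Cosine modes and multiplier operators. -/

noncomputable section

namespace FKdV

namespace HolderEven

open Filter Real intervalIntegral

variable {β : ℝ}

theorem hasDerivAt_cos_nat_mul (n : ℕ) (x : ℝ) :
    HasDerivAt (fun x => cos (n * x)) (-n * sin (n * x)) x := by
  have := ((hasDerivAt_id x).const_mul (n : ℝ)).cos
  convert! this using 1
  simp
  ring

theorem hasDerivAt_sin_nat_mul (n : ℕ) (x : ℝ) :
    HasDerivAt (fun x => sin (n * x)) (n * cos (n * x)) x := by
  have := ((hasDerivAt_id x).const_mul (n : ℝ)).sin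
  convert! this using 1
  simp
  ring

theorem periodic_cos_nat_mul (n : ℕ) :
    Function.Periodic (fun x => cos (n * x)) (2 * π) := fun x => by
  have := cos_add_nat_mul_two_pi (n * x) n
  simp only
  rw [← this]
  ring_nf

/-- `n ^ 2` is a Lipschitz constant and `2 * n` bounds the oscillation; their sum serves for both.
-/
theorem abs_nat_mul_sin_sub_le (n : ℕ) (hβ : β ≤ 2) (x y : ℝ) :
    |(-n * sin (n * x)) - (-n * sin (n * y))| ≤
      ((n : ℝ) ^ 2 + 2 * n) * |x - y| ^ ((β - 1).toNNReal : ℝ) := by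
  have e : (-n * sin (n * x)) - (-n * sin (n * y)) = -(n * (sin (n * x) - sin (n * y))) := by ring
  refine abs_sub_le_mul_rpow (g := fun x => -n * sin (n * x)) (NNReal.coe_nonneg _)
    (toNNReal_sub_one_le hβ) (by positivity) ?_ ?_
  · have h := Convex.norm_image_sub_le_of_norm_hasDerivWithin_le (f := fun x => sin (n * x))
      (s := Set.univ) (C := n) (fun x _ => (hasDerivAt_sin_nat_mul n x).hasDerivWithinAt)
      (fun x _ => by
        rw [norm_mul, norm_eq_abs, norm_eq_abs, Nat.abs_cast]
        exact mul_le_of_le_one_right (by positivity) (abs_cos_le_one _))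
      convex_univ (Set.mem_univ y) (Set.mem_univ x)
    simp only [norm_eq_abs] at h
    simp only [e, abs_neg, abs_mul, Nat.abs_cast]
    have h' := mul_le_mul_of_nonneg_left h (Nat.cast_nonneg (α := ℝ) n)
    have : 0 ≤ 2 * n * |x - y| := by positivity
    nlinarith
  · simp only [e, abs_neg, abs_mul, Nat.abs_cast]
    have h : |sin (n * x) - sin (n * y)| ≤ 2 := by
      refine (abs_sub _ _).trans ?_
      linarith [abs_sin_le_one (n * x), abs_sin_le_one (n * y)]
    have h' := mul_le_mul_of_nonneg_left h (Nat.cast_nonneg (α := ℝ) n)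
    nlinarith [sq_nonneg (n : ℝ)]

/-- The function `x ↦ cos (n x)`. -/
def cosMode (hβ : β ≤ 2) (n : ℕ) : HolderEven β :=
  ⟨fun x => cos (n * x), mem_holderEvenSubmodule (c := (n : ℝ) ^ 2 + 2 * n)
    (periodic_cos_nat_mul n) (fun x => by simp) (hasDerivAt_cos_nat_mul n) (by fun_prop)
    (by positivity) (abs_nat_mul_sin_sub_le n hβ)⟩

theorem cosMode_apply (hβ : β ≤ 2) (n : ℕ) (x : ℝ) : cosMode hβ n x = cos (n * x) := rfl

theorem deriv_cosMode (hβ : β ≤ 2) (n : ℕ) (x : ℝ) :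
    deriv (cosMode hβ n) x = -n * sin (n * x) := (hasDerivAt_cos_nat_mul n x).deriv

theorem cosMode_mem_periodicSubmodule (hβ : β ≤ 2) {n : ℕ} (hn : n ≠ 0) :
    cosMode hβ n ∈ periodicSubmodule β (2 * π / n) := fun x => by
  have hn' : (n : ℝ) ≠ 0 := by exact_mod_cast hn
  rw [cosMode_apply, cosMode_apply, mul_add, mul_div_cancel₀ _ hn', cos_add_two_pi]

/-! ### Cosine coefficients -/

theorem integral_eq_zero_of_odd {u : ℝ → ℝ} (hu : ∀ x, u (-x) = -u x) :
    ∫ x in (-π)..π, u x = 0 := by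
  have h := integral_comp_neg (f := u) (a := -π) (b := π)
  simp only [hu, neg_neg, intervalIntegral.integral_neg] at h
  linarith

theorem integral_comp_sub_mul_cos {u : ℝ → ℝ} (hu : Continuous u)
    (hp : Function.Periodic u (2 * π)) (n : ℕ) (x : ℝ) :
    ∫ y in (-π)..π, u (x - y) * cos (n * y) =
      cos (n * x) * (∫ y in (-π)..π, u y * cos (n * y)) +
        sin (n * x) * ∫ y in (-π)..π, u y * sin (n * y) := by
  have h1 : ∫ y in (-π)..π, u (x - y) * cos (n * y) =
      ∫ z in (x - π)..(x - -π), u z * cos (n * (x - z)) := by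
    rw [← integral_comp_sub_left (fun z => u z * cos (n * (x - z))) x]
    simp
  have hper : Function.Periodic (fun z => u z * cos (n * (x - z))) (2 * π) := fun z => by
    have := periodic_cos_nat_mul n (x - (z + 2 * π))
    simp only at this ⊢
    rw [hp z, ← this]
    ring_nf
  have h2 := hper.intervalIntegral_add_eq (x - π) (-π)
  rw [show x - π + 2 * π = x - -π by ring, show -π + 2 * π = π by ring] at h2
  rw [h1, h2, ← integral_const_mul, ← integral_const_mul, ← integral_add]
  · congr 1
    ext z
    rw [mul_sub, cos_sub]
    ring
  all_goals exact Continuous.intervalIntegrable (by fun_prop) _ _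

theorem abs_integral_mul_cos_le {u : ℝ → ℝ} {M : ℝ} (hu : ∀ x, |u x| ≤ M) (n : ℕ) :
    |∫ y in (-π)..π, u y * cos (n * y)| ≤ M * (2 * π) := by
  have h := norm_integral_le_of_norm_le_const (a := -π) (b := π) (C := M)
    (f := fun y => u y * cos (n * y)) fun y _ => by
      rw [norm_mul, norm_eq_abs, norm_eq_abs]
      exact (mul_le_of_le_one_right (abs_nonneg _) (abs_cos_le_one _)).trans (hu y)
  rw [norm_eq_abs, show π - -π = 2 * π by ring, abs_of_pos two_pi_pos] at h
  exact h

/-- The normalization of the `n`-th cosine coefficient. -/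
def cosWeight (n : ℕ) : ℝ := if n = 0 then (2 * π)⁻¹ else π⁻¹

theorem cosWeight_nonneg (n : ℕ) : 0 ≤ cosWeight n := by
  unfold cosWeight
  split_ifs <;> positivity

theorem cosWeight_mul_le (n : ℕ) : cosWeight n * (2 * π) ≤ 2 := by
  unfold cosWeight
  have := pi_pos
  split_ifs
  · rw [inv_mul_cancel₀ (by positivity)]
    norm_num
  · rw [mul_left_comm, inv_mul_cancel₀ this.ne', mul_one]

theorem cosWeight_mul_abs_le {n : ℕ} {I M : ℝ} (hM : 0 ≤ M) (h : |I| ≤ M * (2 * π)) :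
    |cosWeight n * I| ≤ 2 * M := by
  rw [abs_mul, abs_of_nonneg (cosWeight_nonneg n)]
  have h1 := mul_le_mul_of_nonneg_left h (cosWeight_nonneg n)
  have h2 := mul_le_mul_of_nonneg_right (cosWeight_mul_le n) hM
  linarith

/-- The `n`-th coefficient of the cosine series of a function. -/
def cosCoef (n : ℕ) : HolderEven β →L[ℝ] ℝ :=
  LinearMap.mkContinuous
    { toFun := fun f => cosWeight n * ∫ y in (-π)..π, f y * cos (n * y)
      map_add' := fun f g => by
        rw [← mul_add, ← integral_add]
        · simp only [coe_add, Pi.add_apply, add_mul]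
        all_goals
          have := f.continuous_coe
          have := g.continuous_coe
          exact Continuous.intervalIntegrable (by fun_prop) _ _
      map_smul' := fun c f => by
        simp only [coe_smul, Pi.smul_apply, smul_eq_mul, mul_assoc, integral_const_mul,
          RingHom.id_apply]
        ring } 2
    fun f => cosWeight_mul_abs_le (norm_nonneg _) (abs_integral_mul_cos_le f.abs_apply_le_norm n)

theorem cosCoef_apply (n : ℕ) (f : HolderEven β) :
    cosCoef n f = cosWeight n * ∫ y in (-π)..π, f y * cos (n * y) := rfl

/-- The projection to the `n`-th term of the cosine series. -/
def cosProj (hβ : β ≤ 2) (n : ℕ) : HolderEven β →L[ℝ] HolderEven β :=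
  (cosCoef n).smulRight (cosMode hβ n)

theorem cosProj_apply (hβ : β ≤ 2) (n : ℕ) (f : HolderEven β) :
    cosProj hβ n f = cosCoef n f • cosMode hβ n := rfl

/-- The sine coefficient of an even function vanishes, so the addition formula turns the convolution
into a single mode. -/
theorem cosProj_apply_apply (hβ : β ≤ 2) (n : ℕ) (f : HolderEven β) (x : ℝ) :
    cosProj hβ n f x = cosWeight n * ∫ y in (-π)..π, f (x - y) * cos (n * y) := by
  have h0 : ∫ y in (-π)..π, f y * sin (n * y) = 0 :=
    integral_eq_zero_of_odd fun y => by rw [f.mem.2.1 y]; simp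
  rw [integral_comp_sub_mul_cos f.continuous_coe f.mem.1, h0, cosProj_apply, coe_smul,
    Pi.smul_apply, cosMode_apply, cosCoef_apply, smul_eq_mul]
  ring

theorem integral_deriv_mul_sin (n : ℕ) (f : HolderEven β) :
    ∫ y in (-π)..π, deriv f y * sin (n * y) = -n * ∫ y in (-π)..π, f y * cos (n * y) := by
  have hc := f.continuous_deriv
  have h := integral_mul_deriv_eq_deriv_mul (a := -π) (b := π) (u := fun y => sin (n * y)) (v := f)
    (u' := fun y => n * cos (n * y)) (v' := deriv f)
    (fun y _ => hasDerivAt_sin_nat_mul n y) (fun y _ => f.hasDerivAt y)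
    (Continuous.intervalIntegrable (by fun_prop) _ _) (hc.intervalIntegrable _ _)
  have hs : sin (n * π) = 0 := sin_nat_mul_pi n
  simp only [mul_neg, sin_neg, hs, neg_zero, zero_mul, sub_zero, zero_sub] at h
  simp only [mul_comm (deriv f _), h, neg_mul]
  rw [← integral_const_mul]
  congr 2
  ext y
  ring

/-- The derivative falls on `f`; here the cosine coefficient vanishes, `deriv f` being odd, and
integration by parts handles the sine coefficient. -/
theorem deriv_cosProj_apply (hβ : β ≤ 2) (n : ℕ) (f : HolderEven β) (x : ℝ) :
    deriv (cosProj hβ n f) x = cosWeight n * ∫ y in (-π)..π, deriv f (x - y) * cos (n * y) := by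
  have h0 : ∫ y in (-π)..π, deriv f y * cos (n * y) = 0 :=
    integral_eq_zero_of_odd fun y => by rw [f.deriv_neg_apply y]; simp
  rw [integral_comp_sub_mul_cos f.continuous_deriv f.periodic_deriv, h0, integral_deriv_mul_sin,
    cosProj_apply, deriv_coe_smul, Pi.smul_apply, deriv_cosMode, cosCoef_apply, smul_eq_mul]
  ring

/-- Convolution with a kernel of mass at most 2 at most doubles each of the three parts of the norm;
the bound must not grow with `n`. -/
theorem norm_cosProj_le (hβ : β ≤ 2) (n : ℕ) : ‖cosProj hβ n‖ ≤ 6 := by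
  refine ContinuousLinearMap.opNorm_le_bound _ (by norm_num) fun f => ?_
  have hf := norm_nonneg f
  have hc := f.continuous_deriv
  have := norm_le (f := cosProj hβ n f) (a := 2 * ‖f‖) (b := 2 * ‖f‖) (c := 2 * ‖f‖) (by positivity)
    (fun x => by
      rw [cosProj_apply_apply]
      exact cosWeight_mul_abs_le hf (abs_integral_mul_cos_le (fun y => f.abs_apply_le_norm _) n))
    (fun x => by
      rw [deriv_cosProj_apply]
      exact cosWeight_mul_abs_le hf (abs_integral_mul_cos_le (fun y => f.abs_deriv_le_norm _) n))
    (fun x x' => by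
      rw [deriv_cosProj_apply, deriv_cosProj_apply, ← mul_sub, ← integral_sub]
      · simp only [← sub_mul]
        rw [mul_assoc]
        refine cosWeight_mul_abs_le (by positivity) (abs_integral_mul_cos_le (fun y => ?_) n)
        have := f.abs_deriv_sub_le_norm (x - y) (x' - y)
        rwa [sub_sub_sub_cancel_right] at this
      all_goals exact Continuous.intervalIntegrable (by fun_prop) _ _)
  linarith

theorem cosProj_mem_periodicSubmodule (hβ : β ≤ 2) (n : ℕ) {p : ℝ} {f : HolderEven β}
    (hf : f ∈ periodicSubmodule β p) : cosProj hβ n f ∈ periodicSubmodule β p := fun x => by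
  have hf' : Function.Periodic f p := hf
  rw [cosProj_apply_apply, cosProj_apply_apply]
  congr 3
  ext y
  rw [add_sub_right_comm, hf']

theorem integral_cos_int_mul {j : ℤ} (hj : j ≠ 0) : ∫ y in (-π)..π, cos (j * y) = 0 := by
  have hj' : (j : ℝ) ≠ 0 := by exact_mod_cast hj
  rw [integral_comp_mul_left (fun y => cos y) hj', integral_cos, mul_neg, sin_neg, sin_int_mul_pi]
  simp

theorem integral_cos_mul_cos {m n : ℕ} (h : m ≠ n) :
    ∫ y in (-π)..π, cos (m * y) * cos (n * y) = 0 := by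
  have e : ∀ y : ℝ, cos (m * y) * cos (n * y) =
      1 / 2 * cos (((m - n : ℤ) : ℝ) * y) + 1 / 2 * cos (((m + n : ℤ) : ℝ) * y) := fun y => by
    push_cast
    rw [sub_mul, add_mul, cos_sub, cos_add]
    ring
  simp only [e]
  rw [integral_add, integral_const_mul, integral_const_mul, integral_cos_int_mul (by omega),
    integral_cos_int_mul (by omega)]
  · simp
  all_goals exact Continuous.intervalIntegrable (by fun_prop) _ _

theorem cosWeight_mul_integral_cos_sq (n : ℕ) :
    cosWeight n * ∫ y in (-π)..π, cos (n * y) * cos (n * y) = 1 := by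
  unfold cosWeight
  have hπ := pi_pos.ne'
  split_ifs with hn
  · simp [hn]
    field_simp
    norm_num
  · have e : ∀ y : ℝ, cos (n * y) * cos (n * y) =
        1 / 2 + 1 / 2 * cos (((2 * n : ℤ) : ℝ) * y) := fun y => by
      push_cast
      rw [mul_assoc, cos_two_mul]
      ring
    simp only [e]
    rw [integral_add, integral_const_mul, integral_cos_int_mul (by omega)]
    · simp
      field_simp
      norm_num
    all_goals exact Continuous.intervalIntegrable (by fun_prop) _ _

theorem cosCoef_cosMode (hβ : β ≤ 2) (m n : ℕ) :
    cosCoef n (cosMode hβ m) = if m = n then 1 else 0 := by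
  rw [cosCoef_apply]
  simp only [cosMode_apply]
  split_ifs with h
  · rw [h, cosWeight_mul_integral_cos_sq]
  · rw [integral_cos_mul_cos h, mul_zero]

/-! ### Multipliers with absolutely summable symbol -/

/-- The multiplier operator that multiplies the `n`-th cosine coefficient by `a n`. -/
def multiplier (hβ : β ≤ 2) (a : ℕ → ℝ) : HolderEven β →L[ℝ] HolderEven β :=
  ∑' n, a n • cosProj hβ n

/-- The uniform bound on the projections gives absolute convergence in operator norm. -/
theorem hasSum_multiplier (hβ : β ≤ 2) {a : ℕ → ℝ} (ha : Summable a) :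
    HasSum (fun n => a n • cosProj hβ n) (multiplier hβ a) := by
  refine (Summable.of_norm_bounded (ha.abs.mul_right 6) fun n => ?_).hasSum
  rw [norm_smul, norm_eq_abs]
  exact mul_le_mul_of_nonneg_left (norm_cosProj_le hβ n) (abs_nonneg _)

theorem hasSum_multiplier_apply (hβ : β ≤ 2) {a : ℕ → ℝ} (ha : Summable a) (f : HolderEven β) :
    HasSum (fun n => a n • cosProj hβ n f) (multiplier hβ a f) := by
  have := (ContinuousLinearMap.apply ℝ (HolderEven β) f).hasSum (hasSum_multiplier hβ ha)
  simpa only [Function.comp_def, ContinuousLinearMap.apply_apply, _root_.smul_apply] using this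

theorem multiplier_add (hβ : β ≤ 2) {a b : ℕ → ℝ} (ha : Summable a) (hb : Summable b) :
    multiplier hβ (a + b) = multiplier hβ a + multiplier hβ b := by
  refine (hasSum_multiplier hβ (ha.add hb)).unique ?_
  convert! (hasSum_multiplier hβ ha).add (hasSum_multiplier hβ hb) using 2
  exact add_smul _ _ _

theorem multiplier_smul (hβ : β ≤ 2) (c : ℝ) {a : ℕ → ℝ} (ha : Summable a) :
    multiplier hβ (c • a) = c • multiplier hβ a := by
  refine (hasSum_multiplier hβ (ha.const_smul c)).unique ?_
  convert! (hasSum_multiplier hβ ha).const_smul c using 2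
  exact smul_assoc _ _ _

theorem multiplier_single (hβ : β ≤ 2) (k : ℕ) :
    multiplier hβ (Pi.single k 1) = cosProj hβ k := by
  unfold multiplier
  rw [tsum_eq_single k fun n hn => by rw [Pi.single_eq_of_ne hn, zero_smul], Pi.single_eq_same,
    one_smul]

theorem cosCoef_multiplier (hβ : β ≤ 2) {a : ℕ → ℝ} (ha : Summable a) (n : ℕ) (f : HolderEven β) :
    cosCoef n (multiplier hβ a f) = a n * cosCoef n f := by
  refine ((cosCoef n).hasSum (hasSum_multiplier_apply hβ ha f)).unique ?_
  convert! hasSum_single (f := fun m => cosCoef n (a m • cosProj hβ m f)) n fun m hm => ?_ using 1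
  · simp [cosProj_apply, cosCoef_cosMode]
  · simp [cosProj_apply, cosCoef_cosMode, hm]

theorem multiplier_multiplier (hβ : β ≤ 2) {a b : ℕ → ℝ} (ha : Summable a) (hb : Summable b)
    (hab : Summable (a * b)) (f : HolderEven β) :
    multiplier hβ a (multiplier hβ b f) = multiplier hβ (a * b) f := by
  refine (hasSum_multiplier_apply hβ ha _).unique ?_
  convert! hasSum_multiplier_apply hβ hab f using 2 with n
  rw [cosProj_apply, cosProj_apply, cosCoef_multiplier hβ hb, Pi.mul_apply, smul_smul, smul_smul,
    mul_assoc]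

theorem multiplier_cosMode (hβ : β ≤ 2) {a : ℕ → ℝ} (ha : Summable a) (k : ℕ) :
    multiplier hβ a (cosMode hβ k) = a k • cosMode hβ k := by
  refine (hasSum_multiplier_apply hβ ha _).unique ?_
  convert! hasSum_single (f := fun n => a n • cosProj hβ n (cosMode hβ k)) k fun m hm => ?_ using 1
  · simp [cosProj_apply, cosCoef_cosMode]
  · simp [cosProj_apply, cosCoef_cosMode, hm.symm]

theorem multiplier_mem_periodicSubmodule (hβ : β ≤ 2) {a : ℕ → ℝ} (ha : Summable a) {p : ℝ}
    {f : HolderEven β} (hf : f ∈ periodicSubmodule β p) :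
    multiplier hβ a f ∈ periodicSubmodule β p :=
  (isClosed_periodicSubmodule p).mem_of_tendsto (hasSum_multiplier_apply hβ ha f)
    (Eventually.of_forall fun _ => Submodule.sum_mem _ fun n _ =>
      Submodule.smul_mem _ _ (cosProj_mem_periodicSubmodule hβ n hf))

/-- The multipliers `(μ + a n)` and `(μ⁻¹ + b n)` are inverse to each other. -/
theorem add_multiplier_leftInverse (hβ : β ≤ 2) {μ : ℝ} {a b : ℕ → ℝ} (ha : Summable a)
    (hb : Summable b) (hab : ∀ n, (μ + a n) * (μ⁻¹ + b n) = 1) (hμ : μ ≠ 0) (f : HolderEven β) :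
    μ • (μ⁻¹ • f + multiplier hβ b f) + multiplier hβ a (μ⁻¹ • f + multiplier hβ b f) = f := by
  -- This is `hab` expanded; it also shows that the product symbol is summable.
  have e : a * b = -μ • b + -μ⁻¹ • a := by
    funext n
    have := hab n
    have h2 : μ * μ⁻¹ = 1 := mul_inv_cancel₀ hμ
    simp only [Pi.mul_apply, Pi.add_apply, Pi.smul_apply, smul_eq_mul]
    linear_combination this - h2
  have hs1 : Summable (-μ • b) := hb.const_smul (-μ)
  have hs2 : Summable (-μ⁻¹ • a) := ha.const_smul (-μ⁻¹)
  rw [map_add, multiplier_multiplier hβ ha hb (by rw [e]; exact hs1.add hs2), e,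
    multiplier_add hβ hs1 hs2, multiplier_smul hβ _ hb, multiplier_smul hβ _ ha, map_smul, smul_add,
    smul_inv_smul₀ hμ]
  simp only [_root_.add_apply, _root_.smul_apply]
  module

/-- The multiplier operator with symbol `μ + a n`, as an isomorphism. -/
def addMultiplierEquiv (hβ : β ≤ 2) {μ : ℝ} {a b : ℕ → ℝ} (ha : Summable a)
    (hb : Summable b) (hab : ∀ n, (μ + a n) * (μ⁻¹ + b n) = 1) (hμ : μ ≠ 0) :
    HolderEven β ≃L[ℝ] HolderEven β :=
  ContinuousLinearEquiv.equivOfInverse (μ • .id ℝ (HolderEven β) + multiplier hβ a)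
    (μ⁻¹ • .id ℝ (HolderEven β) + multiplier hβ b)
    (fun f => by
      have := add_multiplier_leftInverse hβ (μ := μ⁻¹) hb ha
        (fun n => by rw [inv_inv, mul_comm]; exact hab n) (inv_ne_zero hμ) f
      simpa only [inv_inv, _root_.add_apply, _root_.smul_apply, ContinuousLinearMap.id_apply]
        using this)
    (fun f => by
      simpa only [_root_.add_apply, _root_.smul_apply, ContinuousLinearMap.id_apply]
        using add_multiplier_leftInverse hβ ha hb hab hμ f)

end HolderEven

end FKdV

end

/-! ### The Bessel symbol and the identification of `L` with a multiplier. -/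

noncomputable section

namespace FKdV

open Real intervalIntegral

theorem symbol_pos (α ξ : ℝ) : 0 < symbol α ξ := rpow_pos_of_pos (by positivity) _

theorem symbol_neg (α ξ : ℝ) : symbol α (-ξ) = symbol α ξ := by rw [symbol, symbol, neg_sq]

/-- Makes the eigenvalue simple: no other cosine mode lies in the kernel. -/
theorem symbol_nat_injective {α : ℝ} (hα : 0 < α) :
    Function.Injective fun n : ℕ => symbol α n := fun m n h => by
  have h1 := (rpow_left_inj (by positivity) (by positivity) (by linarith)).mp h
  have h2 : (m : ℝ) ^ 2 = (n : ℝ) ^ 2 := add_left_cancel h1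
  have h3 := (pow_left_inj₀ (Nat.cast_nonneg m) (Nat.cast_nonneg n) two_ne_zero).mp h2
  exact_mod_cast h3

theorem summable_symbol_nat {α : ℝ} (hα : 1 < α) : Summable fun n : ℕ => symbol α n := by
  refine Summable.of_norm_bounded_eventually_nat (summable_nat_rpow.mpr (neg_lt_neg hα)) ?_
  filter_upwards [Filter.eventually_gt_atTop 0] with n hn
  have hn' : (0 : ℝ) < n := by exact_mod_cast hn
  have e : (n : ℝ) ^ (-α) = ((n : ℝ) ^ 2) ^ (-α / 2) := by
    rw [← rpow_natCast, ← rpow_mul hn'.le]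
    congr 1
    push_cast
    ring
  rw [norm_of_nonneg (symbol_pos α n).le, e]
  exact rpow_le_rpow_of_nonpos (by positivity) (by linarith) (by linarith)

namespace HolderEven

variable {β : ℝ}

theorem fourierCoef_eq (f : HolderEven β) (n : ℤ) :
    fourierCoef f n = ((∫ y in (-π)..π, f y * cos (n.natAbs * y) : ℝ) : ℂ) := by
  have hc := f.continuous_coe
  have h0 : ∫ y in (-π)..π, f y * sin (n * y) = 0 :=
    integral_eq_zero_of_odd fun y => by rw [f.mem.2.1 y]; simp
  have e : ∀ y : ℝ, (f y : ℂ) * Complex.exp (-Complex.I * n * y) =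
      ((f y * cos (n * y) : ℝ) : ℂ) - Complex.I * ((f y * sin (n * y) : ℝ) : ℂ) := fun y => by
    rw [show -Complex.I * n * y = ((-(n * y) : ℝ) : ℂ) * Complex.I by push_cast; ring,
      Complex.exp_mul_I, ← Complex.ofReal_cos, ← Complex.ofReal_sin, cos_neg, sin_neg]
    push_cast
    ring
  have hcos : ∀ y : ℝ, cos (n.natAbs * y) = cos (n * y) := fun y => by
    rw [Nat.cast_natAbs, Int.cast_abs]
    rcases abs_choice (n : ℝ) with h | h <;> rw [h]
    rw [neg_mul, cos_neg]
  rw [fourierCoef]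
  simp only [e, hcos]
  rw [integral_sub, integral_const_mul, integral_ofReal, integral_ofReal, h0]
  · simp
  all_goals exact Continuous.intervalIntegrable (by fun_prop) _ _

theorem re_multiplier_term (f : HolderEven β) (α x : ℝ) (n : ℤ) :
    ((symbol α n : ℂ) * fourierCoef f n * Complex.exp (Complex.I * n * x)).re =
      symbol α n * (∫ y in (-π)..π, f y * cos (n.natAbs * y)) * cos (n * x) := by
  rw [fourierCoef_eq, ← Complex.ofReal_mul, Complex.re_ofReal_mul,
    show Complex.I * n * x = ((n * x : ℝ) : ℂ) * Complex.I by push_cast; ring,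
    Complex.exp_ofReal_mul_I_re]

theorem summable_multiplier_term {α : ℝ} (hα : 1 < α) (f : HolderEven β) (x : ℝ) :
    Summable fun n : ℤ =>
      (symbol α n : ℂ) * fourierCoef f n * Complex.exp (Complex.I * n * x) := by
  have hs : Summable fun n : ℤ => symbol α n := by
    refine Summable.of_nat_of_neg (by simpa using summable_symbol_nat hα) ?_
    simpa [symbol_neg] using summable_symbol_nat hα
  refine Summable.of_norm_bounded (hs.mul_right (‖f‖ * (2 * π))) fun n => ?_
  rw [fourierCoef_eq, norm_mul, norm_mul,
    show Complex.I * n * x = ((n * x : ℝ) : ℂ) * Complex.I by push_cast; ring,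
    Complex.norm_exp_ofReal_mul_I, mul_one, Complex.norm_real, Complex.norm_real,
    norm_of_nonneg (symbol_pos α n).le]
  exact mul_le_mul_of_nonneg_left (abs_integral_mul_cos_le f.abs_apply_le_norm _)
    (symbol_pos α n).le

/-- For even `f` the terms `n` and `-n` have equal real parts and fold into one cosine term; this is
why `cosWeight` is halved at 0. -/
theorem L_eq_multiplier {α : ℝ} (hα : 1 < α) (hβ : β ≤ 2) (f : HolderEven β) (x : ℝ) :
    L α f x = multiplier hβ (fun n => symbol α n) f x := by
  set S := multiplier hβ (fun n => symbol α n) f x with hS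
  set h : ℕ → ℝ := fun n => symbol α n * (cosCoef n f * cos (n * x)) with hh
  have hsum : HasSum h S :=
    (evalL x).hasSum (hasSum_multiplier_apply hβ (summable_symbol_nat hα) f)
  set g : ℤ → ℝ := fun n => (1 / (2 * π)) *
    (symbol α n * (∫ y in (-π)..π, f y * cos (n.natAbs * y)) * cos (n * x)) with hg
  have hπ := pi_pos.ne'
  have g0 : g 0 = h 0 := by
    simp only [hg, hh, cosCoef_apply, cosWeight]
    simp
    ring
  have g1 : ∀ n : ℕ, g ((n + 1 : ℕ) : ℤ) = 1 / 2 * h (n + 1) := fun n => by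
    simp only [hg, hh, cosCoef_apply, cosWeight, Int.natAbs_natCast, Int.cast_natCast]
    rw [if_neg (Nat.succ_ne_zero n)]
    field_simp
  have gneg : ∀ n : ℕ, g (-(n + 1 : ℤ)) = g ((n + 1 : ℕ) : ℤ) := fun n => by
    have e : (-(n + 1 : ℤ)).natAbs = n + 1 := by omega
    simp only [hg, e, Int.natAbs_natCast]
    push_cast
    rw [symbol_neg, neg_mul, cos_neg]
  have htail : HasSum (fun n : ℕ => g ((n + 1 : ℕ) : ℤ)) (1 / 2 * (S - h 0)) := by
    simp only [g1]
    have := (hasSum_nat_add_iff' 1).mpr hsum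
    simp only [Finset.sum_range_one] at this
    exact this.mul_left _
  have hnat : HasSum (fun n : ℕ => g n) (1 / 2 * (S - h 0) + h 0) := by
    rw [← hasSum_nat_add_iff' 1]
    simpa [g0] using htail
  have hint : HasSum g S := by
    have := hnat.of_nat_of_neg_add_one (by simpa only [gneg] using htail)
    convert! this using 1
    ring
  have hre := Complex.hasSum_re (summable_multiplier_term hα f x).hasSum
  simp only [re_multiplier_term] at hre
  have hfin := (hre.mul_left (1 / (2 * π))).unique hint
  rw [L, ← hfin, show (1 / (2 * (π : ℂ))) = ((1 / (2 * π) : ℝ) : ℂ) by push_cast; ring,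
    Complex.re_ofReal_mul]

end HolderEven

open HolderEven

theorem F_eq_zero_iff {α β : ℝ} (hα : 1 < α) (hβ : β ≤ 2) (μ₀ μ : ℝ) (φ : HolderEven β) :
    F α φ μ = 0 ↔
      (μ₀ • ContinuousLinearMap.id ℝ (HolderEven β) - multiplier hβ (fun n => symbol α n)) φ +
        (μ - μ₀) • φ - ((1 / 2 : ℝ) • mulL hβ) φ φ = 0 := by
  have e : ∀ x, F α φ μ x =
      ((μ₀ • ContinuousLinearMap.id ℝ (HolderEven β) - multiplier hβ (fun n => symbol α n)) φ +
        (μ - μ₀) • φ - ((1 / 2 : ℝ) • mulL hβ) φ φ) x := fun x => by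
    simp only [F, L_eq_multiplier hα hβ, _root_.sub_apply, _root_.smul_apply,
      ContinuousLinearMap.id_apply, coe_sub, coe_add, coe_smul, Pi.sub_apply, Pi.add_apply,
      Pi.smul_apply, smul_eq_mul, mulL_apply]
    ring
  constructor
  · intro h
    exact HolderEven.ext fun x => by rw [← e, h]; rfl
  · intro h
    funext x
    rw [e, h]
    rfl

end FKdV

end

/-! ### Application to the equation `F(φ, μ) = 0`. -/

open FKdV FKdV.HolderEven in
theorem exists_analytic_bifurcation_fkdv (α β : ℝ) (hα : 1 < α) (hβ : β ≤ 2) (k : ℕ) (hk : 1 ≤ k) :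
    ∃ ε₀ : ℝ, 0 < ε₀ ∧ ∃ (φ : ℝ → FKdV.HolderEven β) (μ : ℝ → ℝ),
      AnalyticOnNhd ℝ φ (Set.Ioo (-ε₀) ε₀) ∧ AnalyticOnNhd ℝ μ (Set.Ioo (-ε₀) ε₀) ∧
      φ 0 = 0 ∧ μ 0 = symbol α k ∧
      (∀ ε ∈ Set.Ioo (-ε₀) ε₀, 0 ≤ μ ε ∧ FKdV.F α (φ ε) (μ ε) = 0 ∧
        Function.Periodic (φ ε) (2 * Real.pi / k)) ∧
      (∀ ε ∈ Set.Ioo (-ε₀) ε₀, ε ≠ 0 → φ ε ≠ 0) ∧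
      HasDerivAt φ (cosMode hβ k) 0 ∧
      ∃ U ∈ 𝓝 ((0 : FKdV.HolderEven β), symbol α k),
        ∀ p ∈ U, p ∈ FKdV.nontrivialSolutions α β →
          ∃ ε ∈ Set.Ioo (-ε₀) ε₀, ε ≠ 0 ∧ p = (φ ε, μ ε) := by
  set m : ℕ → ℝ := fun n => symbol α n with hm
  have hms : Summable m := summable_symbol_nat hα
  set μ₀ := symbol α k with hμ₀
  have hμ₀0 : 0 < μ₀ := symbol_pos α k
  -- `μ₀ + a n` is the symbol of `A`: it is `μ₀ - m n` off `k`, and the added projection makes it 1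
  -- at `k`.
  set a : ℕ → ℝ := (-1 : ℝ) • m + Pi.single k 1 with ha
  have hsing : Summable (Pi.single k 1 : ℕ → ℝ) := (hasSum_pi_single k (1 : ℝ)).summable
  have hneg : Summable ((-1 : ℝ) • m) := hms.const_smul (-1 : ℝ)
  have has : Summable a := hneg.add hsing
  have hne : ∀ n, μ₀ + a n ≠ 0 := fun n => by
    rcases eq_or_ne n k with rfl | h
    · simp [ha, hm, hμ₀]
    · have := (symbol_nat_injective (zero_lt_one.trans hα)).ne h
      simp only [ha, hm, hμ₀, Pi.add_apply, Pi.smul_apply, Pi.single_eq_of_ne h, smul_eq_mul]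
      contrapose! this
      linarith
  set b : ℕ → ℝ := fun n => (μ₀ + a n)⁻¹ - μ₀⁻¹ with hb
  have hab : ∀ n, (μ₀ + a n) * (μ₀⁻¹ + b n) = 1 := fun n => by
    rw [hb, add_sub_cancel, mul_inv_cancel₀ (hne n)]
  have hbs : Summable b := by
    -- `b n = -a n / (μ₀ (μ₀ + a n))` has a convergent prefactor, so `b` inherits summability from
    -- `a`.
    have hlim : Filter.Tendsto (fun n => |-(μ₀ * (μ₀ + a n))⁻¹|) Filter.atTop
        (𝓝 |-(μ₀ * (μ₀ + 0))⁻¹|) :=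
      ((((has.tendsto_atTop_zero.const_add μ₀).const_mul μ₀).inv₀ (by
        rw [add_zero]; positivity)).neg).abs
    refine Summable.of_norm_bounded_eventually_nat
      (has.abs.mul_left (|-(μ₀ * (μ₀ + 0))⁻¹| + 1)) ?_
    filter_upwards [hlim.eventually_le_const (lt_add_one _)] with n hn
    have e : b n = -(μ₀ * (μ₀ + a n))⁻¹ * a n := by
      have := hne n
      simp only [hb]
      field_simp
      ring
    rw [e, norm_mul, Real.norm_eq_abs, Real.norm_eq_abs]
    exact mul_le_mul_of_nonneg_right hn (abs_nonneg _)
  let A := addMultiplierEquiv hβ has hbs hab hμ₀0.ne'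
  let T : HolderEven β →L[ℝ] HolderEven β := μ₀ • .id ℝ (HolderEven β) - multiplier hβ m
  let B : HolderEven β →L[ℝ] HolderEven β →L[ℝ] HolderEven β := (1 / 2 : ℝ) • mulL hβ
  have hA : ∀ w, A w = T w + cosCoef k w • cosMode hβ k := fun w => by
    have : A w = (μ₀ • .id ℝ (HolderEven β) + multiplier hβ a) w := rfl
    rw [this, ha, multiplier_add hβ hneg hsing, multiplier_smul hβ _ hms, multiplier_single,
      ← cosProj_apply hβ]
    simp only [T, _root_.add_apply, _root_.sub_apply, _root_.smul_apply]
    module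
  have hAsymm : ∀ w, A.symm w = μ₀⁻¹ • w + multiplier hβ b w := fun w => rfl
  have hTc : T (cosMode hβ k) = 0 := by
    simp only [T, _root_.sub_apply, _root_.smul_apply, ContinuousLinearMap.id_apply,
      multiplier_cosMode hβ hms]
    exact sub_self _
  have hlT : ∀ w, cosCoef k (T w) = 0 := fun w => by
    simp only [T, _root_.sub_apply, _root_.smul_apply, ContinuousLinearMap.id_apply, map_sub,
      map_smul, cosCoef_multiplier hβ hms, smul_eq_mul]
    exact sub_self _
  have hlc : cosCoef k (cosMode hβ k) = 1 := by rw [cosCoef_cosMode, if_pos rfl]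
  let Y := periodicSubmodule β (2 * Real.pi / k)
  -- As `μ₀ > 0`, shrinking the curve keeps `μ` nonnegative.
  have hV : {ν : ℝ | 0 ≤ μ₀ + ν} ∈ 𝓝 (0 : ℝ) := by
    filter_upwards [lt_mem_nhds (neg_lt_zero.mpr hμ₀0)] with ν hν
    linarith
  obtain ⟨ε₀, hε₀, φ, ν, hφa, hνa, hφ0, hν0, hsol, hder, U, hU, huniq⟩ :=
    exists_analytic_bifurcation A T (cosCoef k) (cosMode hβ k) B hA hTc hlT hlc Y
      (isClosed_periodicSubmodule _) (cosMode_mem_periodicSubmodule hβ (by omega))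
      (fun f hf => Y.sub_mem (Y.smul_mem _ hf) (multiplier_mem_periodicSubmodule hβ hms hf))
      (fun f hf => by
        rw [hAsymm]
        exact Y.add_mem (Y.smul_mem _ hf) (multiplier_mem_periodicSubmodule hβ hbs hf))
      (fun f hf => Y.smul_mem _ fun x => by
        have hf' : Function.Periodic f (2 * Real.pi / k) := hf
        change f (x + 2 * Real.pi / k) * f (x + 2 * Real.pi / k) = f x * f x
        rw [hf'])
      hV
  refine ⟨ε₀, hε₀, φ, fun ε => μ₀ + ν ε, hφa, fun ε hε => analyticAt_const.add (hνa ε hε), hφ0,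
    by simp [hν0], fun ε hε => ?_, fun ε hε hε0 h => ?_, hder,
    (fun p : HolderEven β × ℝ => (p.1, p.2 - μ₀)) ⁻¹' U, ?_, fun p hp hps => ?_⟩
  · obtain ⟨h1, h2, -, h4⟩ := hsol ε hε
    exact ⟨h4, (F_eq_zero_iff hα hβ μ₀ _ _).mpr (by rw [add_sub_cancel_left]; exact h1), h2⟩
  -- The `k`-th cosine coefficient of `φ ε` is exactly `ε`.
  · have := (hsol ε hε).2.2.1
    rw [h, map_zero] at this
    exact hε0 this.symm
  · have : ContinuousAt (fun p : HolderEven β × ℝ => (p.1, p.2 - μ₀)) (0, μ₀) := by fun_prop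
    refine this.preimage_mem_nhds ?_
    rw [sub_self]
    exact hU
  · obtain ⟨ε, hε, hε0, h⟩ := huniq _ hp ((F_eq_zero_iff hα hβ μ₀ _ _).mp hps.2.1) hps.2.2
    refine ⟨ε, hε, hε0, ?_⟩
    rw [Prod.ext_iff] at h ⊢
    exact ⟨h.1, eq_add_of_sub_eq' h.2⟩

theorem theorem5p1 (α β : ℝ) (hα : 1 < α) (hβ : β ∈ Set.Ioo (1 : ℝ) 2) (k : ℕ) (hk : 1 ≤ k) :
    FKdV.IsBifurcationPoint α β ((1 + (k : ℝ) ^ 2) ^ (-α / 2)) ∧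
    ∃ ε₀ : ℝ, 0 < ε₀ ∧ ∃ (φ : ℝ → FKdV.HolderEven β) (μ : ℝ → ℝ),
      AnalyticOnNhd ℝ φ (Set.Ioo (-ε₀) ε₀) ∧ AnalyticOnNhd ℝ μ (Set.Ioo (-ε₀) ε₀) ∧
      φ 0 = 0 ∧ μ 0 = (1 + (k : ℝ) ^ 2) ^ (-α / 2) ∧
      (∀ ε ∈ Set.Ioo (-ε₀) ε₀, 0 ≤ μ ε ∧ FKdV.F α (φ ε) (μ ε) = 0 ∧
        Function.Periodic (φ ε) (2 * Real.pi / k)) ∧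
      (∀ ε ∈ Set.Ioo (-ε₀) ε₀, ε ≠ 0 → φ ε ≠ 0) ∧
      (∃ c : FKdV.HolderEven β, (∀ x, c x = Real.cos (k * x)) ∧ HasDerivAt φ c 0) ∧
      ∃ U ∈ 𝓝 ((0 : FKdV.HolderEven β), (1 + (k : ℝ) ^ 2) ^ (-α / 2)),
        ∀ p ∈ U, p ∈ FKdV.nontrivialSolutions α β →
          ∃ ε ∈ Set.Ioo (-ε₀) ε₀, ε ≠ 0 ∧ p = (φ ε, μ ε) := by
  obtain ⟨ε₀, hε₀, φ, μ, hφ, hμ, hφ0, hμ0, hsol, hne, hder, hU⟩ :=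
    exists_analytic_bifurcation_fkdv α β hα hβ.2.le k hk
  refine ⟨?_, ε₀, hε₀, φ, μ, hφ, hμ, hφ0, hμ0, hsol, hne, ⟨_, fun _ => rfl, hder⟩, hU⟩
  have h0 : (0 : ℝ) ∈ Set.Ioo (-ε₀) ε₀ := ⟨by linarith, hε₀⟩
  have hlim : Filter.Tendsto (fun ε => (φ ε, μ ε)) (𝓝[≠] (0 : ℝ)) (𝓝 (φ 0, μ 0)) :=
    ((hφ 0 h0).continuousAt.prodMk (hμ 0 h0).continuousAt).tendsto.mono_left nhdsWithin_le_nhds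
  rw [hφ0, hμ0] at hlim
  refine mem_closure_of_tendsto hlim ?_
  filter_upwards [self_mem_nhdsWithin, nhdsWithin_le_nhds (isOpen_Ioo.mem_nhds h0)] with ε hε hεI
  exact ⟨(hsol ε hεI).1, (hsol ε hεI).2.1, hne ε hεI hε⟩
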